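/- Strings are bit strings, $|x|$ is the length of $x\in\{0,1\}^*$, and "polynomial time" means time polynomial in the length of the (encoded) input; a finite sequence $x_1,\dots,x_t$ is encoded with separators, so its length is, up to a constant factor, $\sum_{i}(|x_i|+1)$. Let $X\subseteq\{0,1\}^*$, and let $\kappa:\{0,1\}^*\to\mathbb N$ be a parameterization, i.e. a polynomial-time computable function, such that $\kappa(x)$ is bounded by a polynomial in $|x|$ (for example $\kappa(x)\le|x|$). A *psize kernelization* of $(X,\kappa)$ is a polynomial-time algorithm that on input $x$, with $k=\kappa(x)$, outputs strings $q_1,\dots,q_r$ and a Boolean circuit $\phi$ with $r$ inputs such that $r$, each $|q_j|$ and the size of $\phi$ are bounded by a polynomial in $k$, and $x\in X$ if and only if $\phi$ accepts $(q_1\in X,\dots,q_r\in X)$. $(X,\kappa)$ is *and-compositional* (*or-compositional*) if there is a polynomial-time algorithm that, given strings $x_1,\dots,x_t$ ($t\ge1$) with $\kappa(x_1)=\dots=\kappa(x_t)=k$, outputs a string $y$ such that $y\in X$ if and only if $x_i\in X$ for all $i$ (for some $i$), and $\kappa(y)$ is bounded by a polynomial in $k$. A *weak and-distillation* (*weak or-distillation*)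 of $X$ into $Y\subseteq\{0,1\}^*$ is a polynomial-time algorithm that, given any finite sequence of strings $x_1,\dots,x_t$, outputs a string $y$ such that $y\in Y$ if and only if $x_i\in X$ for all $i$ (for some $i$), and $|y|$ is bounded by a polynomial in $\max_i|x_i|$ (read as $0$ if $t=0$). Let $C(X)$ be the set of all (encodings of) $\langle\phi,(x_1,\dots,x_t)\rangle$ where $\phi$ is a Boolean circuit with $t$ inputs that accepts $(x_1\in X,\dots,x_t\in X)$. **Theorem.** Suppose that $(X,\kappa)$ has a psize kernelization. If $(X,\kappa)$ is and-compositional, then there is a weak and-distillation of $X$ into $C(X)$. If $(X,\kappa)$ is or-compositional, then there is a weak or-distillation of $X$ into $C(X)$. -/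

import Mathlib

namespace Kernelization

/-- Bit strings, that is, elements of `{0,1}*`. -/
abbrev Str : Type := List Bool

/-! ### Codes of finite sequences of strings -/

/-- Self-delimiting code of a bit string: every bit is preceded by `1`, and the end is marked
by `0`. The code of `x` has length `2 * |x| + 1`. -/
def encodeStr : Str → Str
  | [] => [false]
  | b :: x => true :: b :: encodeStr x

/-- Code of a finite sequence of strings: the concatenation of the self-delimiting codes of its
members. The code of `x₁, …, x_t` has length `∑ i, (2 * |x_i| + 1)`. -/
def encodeSeq (xs : List Str) : Str := xs.flatMap encodeStr

/-- Largest length of a string in the sequence (`0` for the empty sequence). -/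
def maxLength (xs : List Str) : ℕ := (xs.map List.length).foldr max 0

/-! ### Polynomial time -/

/-- `f` is computed by a (multi-stack) Turing machine in time polynomial in the length of the code
of the input. The time bound concerns only elements of `α`, so that taking for `α` a subtype
expresses a restriction on the admissible inputs. -/
def PolyTime {α β : Type} (ea : α → Str) (eb : β → Str) (f : α → β) : Prop :=
  Nonempty (Turing.TM2ComputableInPolyTime ea eb f)

/-- A parameterization: a function from strings to natural numbers that is computable in polynomial
time (with its value written in binary). -/
def IsParameterization (κ : Str → ℕ) : Prop :=
  PolyTime id Computability.encodeNat κ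

/-! ### Boolean circuits -/

/-- Gates of a circuit with `n` inputs. The natural numbers in `not`, `and` and `or` are the positions,
in the list of gates of the circuit, of the gates that feed this gate. -/
inductive Gate (n : ℕ) : Type
  | input (i : Fin n)
  | const (b : Bool)
  | not (j : ℕ)
  | and (j k : ℕ)
  | or (j k : ℕ)

/-- The gate is fed only by gates in positions smaller than `m`. -/
def Gate.Below {n : ℕ} (m : ℕ) : Gate n → Prop
  | .input _ => True
  | .const _ => True
  | .not j => j < m
  | .and j k => j < m ∧ k < m
  | .or j k => j < m ∧ k < m

/-- Value of a gate, given the inputs `a` of the circuit and the values `v` of the earlier gates. -/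
def Gate.eval {n : ℕ} (a : Fin n → Bool) (v : List Bool) : Gate n → Bool
  | .input i => a i
  | .const b => b
  | .not j => !(v.getD j false)
  | .and j k => v.getD j false && v.getD k false
  | .or j k => v.getD j false || v.getD k false

/-- A Boolean circuit (with unbounded fan-out) with `n` inputs: a nonempty, topologically sorted list
of gates. The last gate is the output gate. -/
structure Circuit (n : ℕ) : Type where
  gates : List (Gate n)
  gates_ne_nil : gates ≠ []
  below : ∀ (i : ℕ) (h : i < gates.length), (gates[i]).Below i

/-- Number of gates. -/
def Circuit.size {n : ℕ} (φ : Circuit n) : ℕ := φ.gates.length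

/-- The values of all gates, in order, on input `a`. -/
def Circuit.values {n : ℕ} (φ : Circuit n) (a : Fin n → Bool) : List Bool :=
  φ.gates.foldl (fun v g => v ++ [g.eval a v]) []

/-- The value of the output gate on input `a`. -/
def Circuit.eval {n : ℕ} (φ : Circuit n) (a : Fin n → Bool) : Bool :=
  (φ.values a).getLastD false

/-- Unary code of a natural number, with an end mark. -/
def encodeUnary : ℕ → Str
  | 0 => [false]
  | m + 1 => true :: encodeUnary m

/-- Code of a gate: its kind, followed by its data. -/
def Gate.encode {n : ℕ} : Gate n → Str
  | .input i => encodeUnary 0 ++ encodeUnary i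
  | .const b => encodeUnary 1 ++ [b]
  | .not j => encodeUnary 2 ++ encodeUnary j
  | .and j k => encodeUnary 3 ++ (encodeUnary j ++ encodeUnary k)
  | .or j k => encodeUnary 4 ++ (encodeUnary j ++ encodeUnary k)

/-- Code of a circuit: the codes of its gates, in order. -/
def Circuit.encode {n : ℕ} (φ : Circuit n) : Str := φ.gates.flatMap Gate.encode

/-! ### Circuits together with strings -/

/-- A pair `⟨φ, (x₁, …, x_t)⟩` of a circuit `φ` with `t` inputs and `t` strings. -/
structure CircuitInstance : Type where
  strings : List Str
  circuit : Circuit strings.length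

/-- The string that codes `⟨φ, (x₁, …, x_t)⟩`: the code of the sequence whose first member is the
code of `φ`, and whose other members are `x₁, …, x_t`. -/
def CircuitInstance.encode (c : CircuitInstance) : Str :=
  encodeSeq (c.circuit.encode :: c.strings)

open Classical in
/-- The circuit `φ` accepts `(x₁ ∈ X, …, x_t ∈ X)`. -/
def CircuitInstance.Accepts (c : CircuitInstance) (X : Set Str) : Prop :=
  c.circuit.eval (fun i => decide (c.strings.get i ∈ X)) = true

/-- The set `C(X)` of all (codes of) `⟨φ, (x₁, …, x_t)⟩` such that `φ` is a circuit with `t` inputs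
that accepts `(x₁ ∈ X, …, x_t ∈ X)`. -/
def circuitSet (X : Set Str) : Set Str :=
  {w | ∃ c : CircuitInstance, c.encode = w ∧ c.Accepts X}

/-! ### Kernelization, composition and distillation -/

/-- `(X, κ)` has a psize kernelization: in polynomial time one computes from `x` a sequence of queries
and a circuit (hence all queries are made before any answer is known), such that, with `k = κ(x)`, both
the number and the lengths of the queries and the size of the circuit are bounded by a polynomial in
`k`, and `x ∈ X` exactly if the circuit accepts the answers that an oracle for `X` gives. -/
def HasPsizeKernelization (X : Set Str) (κ : Str → ℕ) : Prop :=
  ∃ K : Str → CircuitInstance,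
    PolyTime id CircuitInstance.encode K ∧
    (∀ x, x ∈ X ↔ (K x).Accepts X) ∧
    ∃ p : Polynomial ℕ, ∀ x,
      (K x).strings.length ≤ p.eval (κ x) ∧
      (∀ q ∈ (K x).strings, q.length ≤ p.eval (κ x)) ∧
      (K x).circuit.size ≤ p.eval (κ x)

/-- Nonempty finite sequences of strings that share their parameter value. -/
def SameParameter (κ : Str → ℕ) : Type :=
  {xs : List Str // xs ≠ [] ∧ ∀ x ∈ xs, ∀ y ∈ xs, κ x = κ y}

/-- `(X, κ)` is and-compositional. -/
def IsAndCompositional (X : Set Str) (κ : Str → ℕ) : Prop :=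
  ∃ f : SameParameter κ → Str,
    PolyTime (fun xs : SameParameter κ => encodeSeq xs.1) id f ∧
    (∀ xs, f xs ∈ X ↔ ∀ x ∈ xs.1, x ∈ X) ∧
    ∃ p : Polynomial ℕ, ∀ xs, ∀ x ∈ xs.1, κ (f xs) ≤ p.eval (κ x)

/-- `(X, κ)` is or-compositional. -/
def IsOrCompositional (X : Set Str) (κ : Str → ℕ) : Prop :=
  ∃ f : SameParameter κ → Str,
    PolyTime (fun xs : SameParameter κ => encodeSeq xs.1) id f ∧
    (∀ xs, f xs ∈ X ↔ ∃ x ∈ xs.1, x ∈ X) ∧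
    ∃ p : Polynomial ℕ, ∀ xs, ∀ x ∈ xs.1, κ (f xs) ≤ p.eval (κ x)

/-- There is a weak and-distillation of `X` into `Y`. -/
def HasWeakAndDistillation (X Y : Set Str) : Prop :=
  ∃ f : List Str → Str,
    PolyTime encodeSeq id f ∧
    (∀ xs, f xs ∈ Y ↔ ∀ x ∈ xs, x ∈ X) ∧
    ∃ p : Polynomial ℕ, ∀ xs, (f xs).length ≤ p.eval (maxLength xs)

/-- There is a weak or-distillation of `X` into `Y`. -/
def HasWeakOrDistillation (X Y : Set Str) : Prop :=
  ∃ f : List Str → Str,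
    PolyTime encodeSeq id f ∧
    (∀ xs, f xs ∈ Y ↔ ∃ x ∈ xs, x ∈ X) ∧
    ∃ p : Polynomial ℕ, ∀ xs, (f xs).length ≤ p.eval (maxLength xs)

/-! ### The codes are unambiguous -/

theorem encodeStr_append_inj {x y r s : Str} (h : encodeStr x ++ r = encodeStr y ++ s) :
    x = y ∧ r = s := by
  induction x generalizing y with
  | nil => cases y <;> simp_all [encodeStr]
  | cons b x ih =>
    cases y with
    | nil => simp [encodeStr] at h
    | cons c y =>
      simp only [encodeStr, List.cons_append, List.cons.injEq, true_and] at h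
      obtain ⟨rfl, h⟩ := h
      obtain ⟨rfl, rfl⟩ := ih h
      simp

theorem encodeSeq_injective : Function.Injective encodeSeq := by
  intro xs
  induction xs with
  | nil => intro ys h; cases ys with
    | nil => rfl
    | cons y ys => cases y <;> simp [encodeSeq, encodeStr] at h
  | cons x xs ih => intro ys h; cases ys with
    | nil => cases x <;> simp [encodeSeq, encodeStr] at h
    | cons y ys =>
      simp only [encodeSeq, List.flatMap_cons] at h
      obtain ⟨rfl, h2⟩ := encodeStr_append_inj h
      rw [ih h2]

theorem encodeUnary_append_inj {m n : ℕ} {r s : Str}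
    (h : encodeUnary m ++ r = encodeUnary n ++ s) : m = n ∧ r = s := by
  induction m generalizing n with
  | zero => cases n <;> simp_all [encodeUnary]
  | succ m ih =>
    cases n with
    | zero => simp [encodeUnary] at h
    | succ n =>
      simp only [encodeUnary, List.cons_append, List.cons.injEq, true_and] at h
      obtain ⟨rfl, rfl⟩ := ih h
      simp

theorem Gate.encode_append_inj {n : ℕ} {g g' : Gate n} {r s : Str}
    (h : g.encode ++ r = g'.encode ++ s) : g = g' ∧ r = s := by
  cases g <;> cases g' <;> simp only [Gate.encode, List.append_assoc] at h <;>
    obtain ⟨h0, h⟩ := encodeUnary_append_inj h <;> first | omega | skip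
  · obtain ⟨h1, rfl⟩ := encodeUnary_append_inj h
    simp [Fin.ext h1]
  · simpa using h
  · obtain ⟨rfl, rfl⟩ := encodeUnary_append_inj h
    simp
  · obtain ⟨rfl, h2⟩ := encodeUnary_append_inj h
    obtain ⟨rfl, rfl⟩ := encodeUnary_append_inj h2
    simp
  · obtain ⟨rfl, h2⟩ := encodeUnary_append_inj h
    obtain ⟨rfl, rfl⟩ := encodeUnary_append_inj h2
    simp

theorem Circuit.encode_injective {n : ℕ} :
    Function.Injective (Circuit.encode : Circuit n → Str) := by
  have key : ∀ l l' : List (Gate n),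
      l.flatMap Gate.encode = l'.flatMap Gate.encode → l = l' := by
    intro l
    induction l with
    | nil => intro l' h; cases l' with
      | nil => rfl
      | cons g l' => cases g <;> simp [Gate.encode, encodeUnary] at h
    | cons g l ih => intro l' h; cases l' with
      | nil => cases g <;> simp [Gate.encode, encodeUnary] at h
      | cons g' l' =>
        simp only [List.flatMap_cons] at h
        obtain ⟨rfl, h2⟩ := Gate.encode_append_inj h
        rw [ih l' h2]
  rintro ⟨l, _, _⟩ ⟨l', _, _⟩ h
  obtain rfl := key l l' h
  rfl

theorem CircuitInstance.encode_injective : Function.Injective CircuitInstance.encode := by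
  rintro ⟨xs, φ⟩ ⟨ys, ψ⟩ h
  obtain ⟨h1, h2⟩ := List.cons.inj (encodeSeq_injective h)
  dsimp only at h1 h2
  subst h2
  rw [Circuit.encode_injective h1]

/-- The code of `⟨φ, (x₁, …, x_t)⟩` lies in `C(X)` exactly if `φ` accepts `(x₁ ∈ X, …, x_t ∈ X)`. -/
theorem encode_mem_circuitSet {X : Set Str} {c : CircuitInstance} :
    c.encode ∈ circuitSet X ↔ c.Accepts X :=
  ⟨fun ⟨_, h, hX⟩ => CircuitInstance.encode_injective h ▸ hX, fun h => ⟨c, rfl, h⟩⟩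

end Kernelization

/-! Let `m` be the largest length of the given strings. As `κ` is polynomially bounded, they have at
most polynomially many (in `m`) distinct parameter values, however many strings there are. Group the
strings by parameter value. The composition turns each group into one string whose parameter is
polynomial in `m`, and the kernelization turns this string into a circuit with queries, all of size
polynomial in `m`. The conjunction (or disjunction) of these circuits, taken over the concatenated
queries, has a code of length polynomial in `m`; it lies in `C(X)` exactly if all (some) of the
strings lie in `X`. The combination starts from a constant circuit, which also settles the empty
sequence. A Boolean `o` selects conjunction or disjunction, so both claims have one proof,
`exists_distillation`.

The combinatorial core is small: `CircuitInstance.accepts_merge` (joining two circuits),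
`holds_cons_filter` (splitting off one group) and `card_image_filter_lt` (each round removes a
parameter value). Two measures must be kept apart: running times are polynomial in the length `L` of
the whole input, whereas the output must be polynomial in `m` alone.

Most of the work shows that the procedure runs in polynomial time on a stack machine. For this there
is a small language of register programs (`Prog`) with sequencing, loops on popped bits, and calls
of given machines. `Prog.Runs` records the effect on the registers together with a time bound.
`PolyTime.exists_oracle` supplies the machines to be called, and `polyTime_of_runs` converts a
program back into a machine. `processGroups_run` is the invariant of the main loop.

Writing to a stack reverses words. Hence registers hold reversed codes while these are being
assembled, and `call` reads reversed input and writes reversed output. -/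

namespace Kernelization

open Turing Turing.TM2

/-! ### Runs of stack machines -/

section Machine

variable {K : Type} [DecidableEq K] {Γ : K → Type} {Λ Λ' σ : Type}

/-- The program `m` leads from one configuration to the other in exactly the given number of
steps. -/
inductive Steps (m : Λ → Stmt Γ Λ σ) : Cfg Γ Λ σ → Cfg Γ Λ σ → ℕ → Prop
  | refl (c : Cfg Γ Λ σ) : Steps m c c 0
  | head {c c₁ c' : Cfg Γ Λ σ} {n : ℕ} (h : step m c = some c₁) (hs : Steps m c₁ c' n) :
      Steps m c c' (n + 1)

theorem Steps.trans {m : Λ → Stmt Γ Λ σ} {c c₁ c₂ : Cfg Γ Λ σ} {n₁ n₂ : ℕ}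
    (h₁ : Steps m c c₁ n₁) (h₂ : Steps m c₁ c₂ n₂) : Steps m c c₂ (n₁ + n₂) := by
  induction h₁ with
  | refl c => simpa using h₂
  | head h hs ih => rw [Nat.add_right_comm]; exact .head h (ih h₂)

theorem iterate_bind_none {α : Type} (f : α → Option α) (n : ℕ) :
    (flip bind f)^[n] none = none :=
  Function.iterate_fixed rfl n

/-- Passes between the inductive form, suited to composing and simulating runs, and the iteration
used by `TM2OutputsInTime`. -/
theorem steps_iff_iterate {m : Λ → Stmt Γ Λ σ} {c c' : Cfg Γ Λ σ} {n : ℕ} :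
    Steps m c c' n ↔ (flip bind (step m))^[n] (some c) = some c' := by
  constructor
  · intro h
    induction h with
    | refl c => rfl
    | head h hs ih => rw [Function.iterate_succ_apply, ← ih, ← h]; rfl
  · intro h
    induction n generalizing c with
    | zero => obtain rfl := Option.some.inj h; exact .refl c
    | succ n ih =>
      rw [Function.iterate_succ_apply] at h
      cases h' : step m c with
      | none =>
        have : flip bind (step m) (some c) = none := h'
        rw [this, iterate_bind_none] at h
        cases h
      | some c₁ =>
        have : flip bind (step m) (some c) = some c₁ := h'
        rw [this] at h
        exact .head h' (ih h)

/-- Rename the labels of a statement, and replace halting by a jump if `e` is a label. -/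
def relabel (φ : Λ → Λ') (e : Option Λ') : Stmt Γ Λ σ → Stmt Γ Λ' σ
  | .push k f q => .push k f (relabel φ e q)
  | .peek k f q => .peek k f (relabel φ e q)
  | .pop k f q => .pop k f (relabel φ e q)
  | .load f q => .load f (relabel φ e q)
  | .branch f q₁ q₂ => .branch f (relabel φ e q₁) (relabel φ e q₂)
  | .goto f => .goto fun v => φ (f v)
  | .halt => e.elim .halt fun l => .goto fun _ => l

/-- The effect of `relabel` on configurations. -/
def relabelCfg (φ : Λ → Λ') (e : Option Λ') (c : Cfg Γ Λ σ) : Cfg Γ Λ' σ :=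
  ⟨c.l.elim e fun l => some (φ l), c.var, c.stk⟩

theorem stepAux_relabel (φ : Λ → Λ') (e : Option Λ') (q : Stmt Γ Λ σ) (v : σ)
    (S : ∀ k, List (Γ k)) :
    stepAux (relabel φ e q) v S = relabelCfg φ e (stepAux q v S) := by
  induction q generalizing v S with
  | push k f q ih => exact ih _ _
  | peek k f q ih => exact ih _ _
  | pop k f q ih => exact ih _ _
  | load f q ih => exact ih _ _
  | branch f q₁ q₂ ih₁ ih₂ =>
    simp only [relabel, stepAux]
    cases f v
    · exact ih₂ _ _
    · exact ih₁ _ _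
  | goto f => rfl
  | halt => cases e <;> rfl

/-- A run survives embedding into a larger program, with the same number of steps: where the
original halts, the image is already at the label `e`, so continuing costs nothing extra. -/
theorem Steps.relabel {φ : Λ → Λ'} {e : Option Λ'} {m : Λ → Stmt Γ Λ σ} {m' : Λ' → Stmt Γ Λ' σ}
    (hm : ∀ l, m' (φ l) = Kernelization.relabel φ e (m l)) {c c' : Cfg Γ Λ σ} {n : ℕ}
    (h : Steps m c c' n) : Steps m' (relabelCfg φ e c) (relabelCfg φ e c') n := by
  induction h with
  | refl c => exact .refl _
  | @head c c₁ c' n h hs ih =>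
    refine .head ?_ ih
    obtain ⟨l, v, S⟩ := c
    cases l with
    | none => cases h
    | some l =>
      obtain rfl := Option.some.inj h
      simp only [relabelCfg, Option.elim, TM2.step, hm]
      rw [stepAux_relabel]
      rfl

/-- A bound for the number of symbols that the statement pushes. -/
def pushes : Stmt Γ Λ σ → ℕ
  | .push _ _ q => pushes q + 1
  | .peek _ _ q => pushes q
  | .pop _ _ q => pushes q
  | .load _ q => pushes q
  | .branch _ q₁ q₂ => pushes q₁ + pushes q₂
  | .goto _ => 0
  | .halt => 0

/-- `pushes` charges a branch for both alternatives, which makes the bound independent of the state.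
-/
theorem length_stepAux_le (q : Stmt Γ Λ σ) (v : σ) (S : ∀ k, List (Γ k)) (k : K) :
    ((stepAux q v S).stk k).length ≤ (S k).length + pushes q := by
  induction q generalizing v S with
  | push k' f q ih =>
    refine (ih _ _).trans ?_
    rcases eq_or_ne k k' with rfl | h
    · simp [pushes]; omega
    · simp [pushes, h]
  | peek k f q ih => exact ih _ _
  | pop k' f q ih =>
    refine (ih _ _).trans ?_
    rcases eq_or_ne k k' with rfl | h
    · simp [pushes]
    · simp [pushes, h]
  | load f q ih => exact ih _ _
  | branch f q₁ q₂ ih₁ ih₂ =>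
    simp only [pushes, stepAux]
    cases f v
    · exact (ih₂ _ _).trans (by omega)
    · exact (ih₁ _ _).trans (by omega)
  | goto f => simp [pushes]
  | halt => simp [pushes]

theorem Steps.length_le {m : Λ → Stmt Γ Λ σ} {C : ℕ} (hC : ∀ l, pushes (m l) ≤ C)
    {c c' : Cfg Γ Λ σ} {n : ℕ} (h : Steps m c c' n) (k : K) :
    (c'.stk k).length ≤ (c.stk k).length + n * C := by
  induction h with
  | refl c => simp
  | @head c c₁ c' n h hs ih =>
    obtain ⟨l, v, S⟩ := c
    cases l with
    | none => cases h
    | some l =>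
      obtain rfl := Option.some.inj h
      have := length_stepAux_le (m l) v S k
      have := hC l
      dsimp only at ih ⊢
      rw [Nat.succ_mul]
      omega

end Machine

/-! ### Oracle machines -/

/-- The machine `M` computes `w'` from `w` in at most `t` steps. -/
def Answers (M : TM2ComputableAux Bool Bool) (w w' : Str) (t : ℕ) : Prop :=
  Nonempty (TM2OutputsInTime M.tm (w.map M.inputAlphabet.invFun)
    (some (w'.map M.outputAlphabet.invFun)) t)

/-- A time bound limits the output length, because one step lengthens a stack by at most a constant.
This is needed because outputs of one called machine become inputs of another. -/
theorem exists_answers_length_le (M : TM2ComputableAux Bool Bool) :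
    ∃ C : ℕ, ∀ w w' t, Answers M w w' t → w'.length ≤ w.length + t * C := by
  have := M.tm.ΛFin
  -- The sum over the finitely many labels dominates the pushes of every single statement.
  refine ⟨∑ l, pushes (M.tm.m l), ?_⟩
  rintro w w' t ⟨h⟩
  have hs : Steps M.tm.m _ _ _ := steps_iff_iterate.2 h.evals_in_steps
  have := hs.length_le (fun l => Finset.single_le_sum (f := fun l => pushes (M.tm.m l))
    (fun _ _ => Nat.zero_le _) (Finset.mem_univ l)) M.tm.k₁
  have h1 : (((haltList M.tm (w'.map M.outputAlphabet.invFun))).stk M.tm.k₁).length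
      = w'.length := by simp [haltList]
  have h0 : ((initList M.tm (w.map M.inputAlphabet.invFun)).stk M.tm.k₁).length
      ≤ w.length := by
    simp only [initList]
    split_ifs with h
    · generalize M.tm.k₁ = k at h ⊢
      subst h
      simp
    · simp
  have h2 : h.steps ≤ t := h.steps_le_m
  have h3 := Nat.mul_le_mul_right (∑ l, pushes (M.tm.m l)) h2
  rw [h1] at this
  omega

/-! ### Structured programs with registers and oracles -/

theorem update_initList (tm : FinTM2) (w w' : List (tm.Γ tm.k₀)) :
    Function.update (initList tm w).stk tm.k₀ w' = (initList tm w').stk := by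
  funext k
  rcases eq_or_ne k tm.k₀ with rfl | h
  · simp [initList]
  · simp [initList, h]

theorem update_haltList (tm : FinTM2) (w w' : List (tm.Γ tm.k₁)) :
    Function.update (haltList tm w).stk tm.k₁ w' = (haltList tm w').stk := by
  funext k
  rcases eq_or_ne k tm.k₁ with rfl | h
  · simp [haltList]
  · simp [haltList, h]

section Program

variable {I R : Type} (M : I → TM2ComputableAux Bool Bool)

/-- The stacks of a program with registers `R` that calls the machines `M`. -/
abbrev Stacks (R : Type) : Type := R ⊕ (Σ i, (M i).tm.K)

/-- The stack alphabets of a program with registers `R` that calls the machines `M`. -/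
abbrev Alphabet (R : Type) : Stacks M R → Type
  | .inl _ => Bool
  | .inr k => (M k.1).tm.Γ k.2

/-- The internal states of a program: the bit read last, and the states of the machines `M`. -/
abbrev Vars : Type := Option Bool × ∀ i, (M i).tm.σ

/-- The internal state in which no bit is stored and all machines are in their initial state. -/
def initVars : Vars M := (none, fun i => (M i).tm.initialState)

/-- The stacks if the registers hold `s` and all machines have empty stacks. -/
def contents (s : R → Str) : ∀ k : Stacks M R, List (Alphabet M R k)
  | .inl r => s r
  | .inr _ => []

/-- A program with registers `R` that may call the machines `M`. It ends by halting. -/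
structure Prog (R : Type) where
  Λ : Type
  [fin : Fintype Λ]
  entry : Λ
  code : Λ → Stmt (Alphabet M R) Λ (Vars M)

attribute [instance] Prog.fin

variable {M}

variable [DecidableEq I]

/-- The stacks if the registers hold `s`, the machine `M i` has the stacks `T`, and the other
machines have empty stacks. -/
def contentsWith (s : R → Str) (i : I) (T : ∀ k, List ((M i).tm.Γ k)) :
    ∀ k : Stacks M R, List (Alphabet M R k)
  | .inl r => s r
  | .inr k => if h : k.1 = i then cast (by obtain ⟨j, k⟩ := k; cases h; rfl)
      (T (cast (by rw [h]) k.2)) else []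

theorem contentsWith_inr (s : R → Str) (i : I) (T : ∀ k, List ((M i).tm.Γ k)) (k : (M i).tm.K) :
    contentsWith s i T (.inr ⟨i, k⟩) = T k := by
  simp [contentsWith]

theorem contentsWith_nil (s : R → Str) (i : I) :
    contentsWith s i (fun _ => []) = contents M s := by
  funext k'
  rcases k' with r | ⟨j, k'⟩
  · rfl
  · rcases eq_or_ne j i with rfl | h
    · rw [contentsWith_inr]; rfl
    · simp [contentsWith, contents, h]

variable [DecidableEq R]

/-- The program turns the register contents `s` into `s'` in at most `t` steps. -/
def Prog.Runs (P : Prog M R) (s s' : R → Str) (t : ℕ) : Prop :=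
  ∃ n ≤ t, Steps P.code ⟨some P.entry, initVars M, contents M s⟩
    ⟨none, initVars M, contents M s'⟩ n

theorem Prog.Runs.congr {P : Prog M R} {s s' s'' : R → Str} {t t' : ℕ} (h : P.Runs s s' t)
    (hs : s' = s'') (ht : t ≤ t') : P.Runs s s'' t' := by
  obtain ⟨n, hn, h⟩ := h
  exact hs ▸ ⟨n, hn.trans ht, h⟩

/-- The program that does nothing. -/
def skip : Prog M R := ⟨Unit, (), fun _ => .halt⟩

theorem skip_runs (s : R → Str) : (skip : Prog M R).Runs s s 1 :=
  ⟨1, le_rfl, .head rfl (.refl _)⟩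

theorem update_contents (s : R → Str) (r : R) (w : Str) :
    Function.update (contents M s) (.inl r) w = contents M (Function.update s r w) := by
  funext k
  rcases k with r' | k
  · rcases eq_or_ne r' r with rfl | h
    · simp [contents]
    · simp [contents, h]
  · simp [contents]

/-- Push a bit. -/
def push (r : R) (b : Bool) : Prog M R := ⟨Unit, (), fun _ => .push (.inl r) (fun _ => b) .halt⟩

theorem push_runs (r : R) (b : Bool) (s : R → Str) :
    (push r b : Prog M R).Runs s (Function.update s r (b :: s r)) 1 := by
  refine ⟨1, le_rfl, .head ?_ (.refl _)⟩
  simp only [push, TM2.step, stepAux]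
  exact congrArg some (congrArg (Cfg.mk none _) (update_contents s r (b :: s r)))

/-- Run one program after another. -/
def Prog.seq (P Q : Prog M R) : Prog M R where
  Λ := P.Λ ⊕ Q.Λ
  entry := .inl P.entry
  code
    | .inl l => relabel Sum.inl (some (Sum.inr Q.entry)) (P.code l)
    | .inr l => relabel Sum.inr none (Q.code l)

/-- Run one program after another. -/
infixr:60 " ⨟ " => Prog.seq

/-- Halting of `P` is replaced by a jump to the entry of `Q`, so the times simply add up. -/
theorem Prog.Runs.seq {P Q : Prog M R} {s s' s'' : R → Str} {t t' : ℕ} (h : P.Runs s s' t)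
    (h' : Q.Runs s' s'' t') : (P ⨟ Q).Runs s s'' (t + t') := by
  obtain ⟨n, hn, h⟩ := h
  obtain ⟨n', hn', h'⟩ := h'
  exact ⟨n + n', by omega,
    (h.relabel (m' := (P ⨟ Q).code) (φ := Sum.inl) (e := some (Sum.inr Q.entry))
      fun _ => rfl).trans
    (h'.relabel (m' := (P ⨟ Q).code) (φ := Sum.inr) (e := none) fun _ => rfl)⟩

/-- Pop from the register `r`, and run the branch for the result `o` (`none` if the register is
empty). Repeat this after branches with `again o`. -/
def popLoop (r : R) (again : Option Bool → Bool) (P : Option Bool → Prog M R) : Prog M R where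
  Λ := Option (Σ o, (P o).Λ)
  entry := none
  code
    | none => .pop (.inl r) (fun v o => (o, v.2)) <|
        .branch (fun v => v.1 == none)
          (.load (fun v => (none, v.2)) <| .goto fun _ => some ⟨none, (P none).entry⟩) <|
        .branch (fun v => v.1 == some true)
          (.load (fun v => (none, v.2)) <| .goto fun _ => some ⟨some true, (P (some true)).entry⟩)
          (.load (fun v => (none, v.2)) <|
            .goto fun _ => some ⟨some false, (P (some false)).entry⟩)
    | some ⟨o, l⟩ =>
      relabel (fun l => some ⟨o, l⟩) (if again o then some none else none) ((P o).code l)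

/-- Popping, testing and erasing the stored bit form a single statement, hence a single step.
Erasing the bit restores `initVars`, from which every `Runs` must start. -/
theorem popLoop_step {r : R} {again : Option Bool → Bool} {P : Option Bool → Prog M R}
    (s : R → Str) : TM2.step (popLoop r again P).code
      ⟨some none, initVars M, contents M s⟩ =
      some ⟨some (some ⟨(s r).head?, (P (s r).head?).entry⟩), initVars M,
        contents M (Function.update s r (s r).tail)⟩ := by
  have h : Function.update (contents M s) (.inl r) (contents M s (.inl r)).tail =
    contents M (Function.update s r (s r).tail) := update_contents s r (s r).tail
  have h1 : contents M s (.inl r) = s r := rfl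
  simp only [TM2.step, popLoop, stepAux, initVars]
  rw [h, h1]
  rcases s r with _ | ⟨_ | _, l⟩ <;> rfl

theorem popLoop_exit {r : R} {again : Option Bool → Bool} {P : Option Bool → Prog M R}
    {s s' : R → Str} {t : ℕ} {o : Option Bool} (ho : (s r).head? = o)
    (h : (P o).Runs (Function.update s r (s r).tail) s' t) (ha : again o = false) :
    (popLoop r again P).Runs s s' (t + 1) := by
  subst ho
  obtain ⟨n, hn, h⟩ := h
  refine ⟨n + 1, by omega, .head (popLoop_step s) ?_⟩
  have := h.relabel (m' := (popLoop r again P).code) (φ := fun l => some ⟨(s r).head?, l⟩)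
    (e := if again (s r).head? then some none else none) fun _ => rfl
  rw [ha] at this
  exact this

/-- Unrolls one round of a loop. Loops are treated by this rule and `popLoop_exit`, with induction
on the data consumed. -/
theorem popLoop_again {r : R} {again : Option Bool → Bool} {P : Option Bool → Prog M R}
    {s s' s'' : R → Str} {t t' : ℕ} {o : Option Bool} (ho : (s r).head? = o)
    (h : (P o).Runs (Function.update s r (s r).tail) s' t) (ha : again o = true)
    (h' : (popLoop r again P).Runs s' s'' t') :
    (popLoop r again P).Runs s s'' (t + t' + 1) := by
  subst ho
  obtain ⟨n, hn, h⟩ := h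
  obtain ⟨n', hn', h'⟩ := h'
  refine ⟨n + n' + 1, by omega, .head (popLoop_step s) (Steps.trans ?_ h')⟩
  have := h.relabel (m' := (popLoop r again P).code) (φ := fun l => some ⟨(s r).head?, l⟩)
    (e := if again (s r).head? then some none else none) fun _ => rfl
  rw [ha] at this
  exact this

/-! ### Calls of machines -/

/-- The statement `q` of the machine `M i`, as part of a program. -/
def embed (i : I) {Λ : Type} :
    Stmt (M i).tm.Γ (M i).tm.Λ (M i).tm.σ → (φ : (M i).tm.Λ → Λ) → Λ →
      Stmt (Alphabet M R) Λ (Vars M)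
  | .push k f q, φ, e => .push (.inr ⟨i, k⟩) (fun v => f (v.2 i)) (embed i q φ e)
  | .peek k f q, φ, e =>
    .peek (.inr ⟨i, k⟩) (fun v o => (v.1, Function.update v.2 i (f (v.2 i) o))) (embed i q φ e)
  | .pop k f q, φ, e =>
    .pop (.inr ⟨i, k⟩) (fun v o => (v.1, Function.update v.2 i (f (v.2 i) o))) (embed i q φ e)
  | .load f q, φ, e => .load (fun v => (v.1, Function.update v.2 i (f (v.2 i)))) (embed i q φ e)
  | .branch f q₁ q₂, φ, e => .branch (fun v => f (v.2 i)) (embed i q₁ φ e) (embed i q₂ φ e)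
  | .goto f, φ, _ => .goto fun v => φ (f (v.2 i))
  | .halt, _, e => .goto fun _ => e

theorem contentsWith_update (s : R → Str) (i : I) (T : ∀ k, List ((M i).tm.Γ k)) (k : (M i).tm.K)
    (w : List ((M i).tm.Γ k)) :
    Function.update (contentsWith s i T) (.inr ⟨i, k⟩) w
      = contentsWith s i (Function.update T k w) := by
  funext k'
  rcases k' with r | ⟨j, k'⟩
  · simp [contentsWith]
  · rcases eq_or_ne j i with rfl | h
    · rw [contentsWith_inr]
      rcases eq_or_ne k' k with rfl | h
      · simp
      · rw [Function.update_of_ne (by simpa using h), Function.update_of_ne h, contentsWith_inr]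
    · rw [Function.update_of_ne (by simp [h])]
      simp [contentsWith, h]

theorem contentsWith_update_inl (s : R → Str) (i : I) (T : ∀ k, List ((M i).tm.Γ k)) (r : R)
    (w : Str) :
    Function.update (contentsWith s i T) (.inl r) w = contentsWith (Function.update s r w) i T := by
  funext k'
  rcases k' with r' | k
  · rcases eq_or_ne r' r with rfl | h
    · simp [contentsWith]
    · simp [contentsWith, h]
  · simp [contentsWith]

/-- The internal state in which the machine `M i` is in the state `v`. -/
def varsWith (i : I) (v : (M i).tm.σ) : Vars M :=
  (none, Function.update (initVars M).2 i v)

theorem varsWith_init (i : I) : varsWith i (M i).tm.initialState = initVars M := by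
  simp [varsWith, initVars]

/-- The called machine is simulated step by step on its own stacks and its own component of the
state; its halting becomes the jump to `e`. -/
theorem stepAux_embed (i : I) {Λ : Type} (φ : (M i).tm.Λ → Λ) (e : Λ)
    (q : Stmt (M i).tm.Γ (M i).tm.Λ (M i).tm.σ) (v : (M i).tm.σ) (T : ∀ k, List ((M i).tm.Γ k))
    (s : R → Str) :
    stepAux (embed i q φ e) (varsWith i v) (contentsWith s i T) =
      ⟨some ((stepAux q v T).l.elim e φ), varsWith i (stepAux q v T).var,
        contentsWith s i (stepAux q v T).stk⟩ := by
  induction q generalizing v T with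
  | push k f q ih =>
    simp only [embed, stepAux]
    rw [contentsWith_inr, contentsWith_update, ← ih]
    simp [varsWith]
  | peek k f q ih =>
    simp only [embed, stepAux]
    rw [contentsWith_inr, ← ih]
    simp [varsWith]
  | pop k f q ih =>
    simp only [embed, stepAux]
    rw [contentsWith_inr, contentsWith_update, ← ih]
    simp [varsWith]
  | load f q ih =>
    simp only [embed, stepAux]
    rw [← ih]
    simp [varsWith]
  | branch f q₁ q₂ ih₁ ih₂ =>
    simp only [embed, stepAux]
    have : (varsWith i v).2 i = v := by simp [varsWith]
    rw [this]
    cases f v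
    · exact ih₂ _ _
    · exact ih₁ _ _
  | goto f => simp [embed, varsWith]
  | halt => simp [embed]

/-- Labels of the program that calls the machine `M i`. -/
inductive CallLabel (Λ : Type)
  | feed
  | run (l : Λ)
  | fetch

noncomputable instance {Λ : Type} [Fintype Λ] : Fintype (CallLabel Λ) :=
  letI := Classical.decEq (CallLabel Λ)
  Fintype.ofSurjective (fun o : Option (Option Λ) => match o with
    | none => .feed
    | some none => .fetch
    | some (some l) => .run l) <| by
    rintro (_ | l | _)
    · exact ⟨none, rfl⟩
    · exact ⟨some (some l), rfl⟩
    · exact ⟨some none, rfl⟩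

/-- Move the reversed contents of the register `a` to the input stack of the machine `M i`, run this
machine, and move the reversed output to the register `b`. -/
noncomputable def call (i : I) (a b : R) : Prog M R where
  Λ := CallLabel (M i).tm.Λ
  fin := letI := (M i).tm.ΛFin; inferInstance
  entry := .feed
  code
    | .feed => .pop (.inl a) (fun v o => (o, v.2)) <|
        .branch (fun v => v.1 == none)
          (.goto fun _ => .run (M i).tm.main)
          (.push (.inr ⟨i, (M i).tm.k₀⟩) (fun v => (M i).inputAlphabet.symm (v.1.getD false)) <|
            .load (fun v => (none, v.2)) <| .goto fun _ => .feed)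
    | .run l => embed i ((M i).tm.m l) .run .fetch
    | .fetch => .pop (.inr ⟨i, (M i).tm.k₁⟩)
        (fun v o => (o.map (M i).outputAlphabet, v.2)) <|
        .branch (fun v => v.1 == none)
          .halt
          (.push (.inl b) (fun v => (v.1.getD false)) <|
            .load (fun v => (none, v.2)) <| .goto fun _ => .fetch)

theorem call_feed (i : I) (a b : R) (x y : Str) (s : R → Str) (hs : s a = x) :
    Steps (call i a b : Prog M R).code
      ⟨some .feed, initVars M, contentsWith s i (initList (M i).tm
        (y.map (M i).inputAlphabet.invFun)).stk⟩
      ⟨some (.run (M i).tm.main), initVars M, contentsWith (Function.update s a []) i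
        (initList (M i).tm ((x.reverse ++ y).map (M i).inputAlphabet.invFun)).stk⟩
      (x.length + 1) := by
  induction x generalizing y s with
  | nil =>
    refine .head ?_ (.refl _)
    have : contentsWith s i (initList (M i).tm
        (y.map (M i).inputAlphabet.invFun)).stk (.inl a) = [] := hs
    simp only [TM2.step, call, stepAux]
    rw [this, contentsWith_update_inl]
    rfl
  | cons c x ih =>
    refine .head ?_ ((ih (c :: y) (Function.update s a x) (by simp)).trans (n₂ := 0) ?_)
    · have : contentsWith s i (initList (M i).tm
        (y.map (M i).inputAlphabet.invFun)).stk (.inl a) = c :: x := hs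
      simp only [TM2.step, call, stepAux]
      rw [this, contentsWith_update_inl, contentsWith_inr, contentsWith_update, update_initList]
      simp [initVars, initList]
    · simpa using Steps.refl _

theorem call_fetch (i : I) (a b : R) (y : Str) (s : R → Str) :
    Steps (call i a b : Prog M R).code
      ⟨some .fetch, initVars M, contentsWith s i (haltList (M i).tm
        (y.map (M i).outputAlphabet.invFun)).stk⟩
      ⟨none, initVars M, contents M (Function.update s b (y.reverse ++ s b))⟩
      (y.length + 1) := by
  induction y generalizing s with
  | nil =>
    refine .head ?_ (.refl _)
    simp only [TM2.step, call, stepAux]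
    rw [contentsWith_inr, contentsWith_update]
    have : Function.update (haltList (M i).tm (([] : Str).map (M i).outputAlphabet.invFun)).stk
        (M i).tm.k₁ ((haltList (M i).tm (([] : Str).map (M i).outputAlphabet.invFun)).stk
        (M i).tm.k₁).tail = fun _ => [] := by
      funext k
      rcases eq_or_ne k (M i).tm.k₁ with rfl | h
      · simp [haltList]
      · simp [haltList, h]
    rw [this, contentsWith_nil]
    simp [haltList, initVars]
  | cons c y ih =>
    refine .head ?_ ((ih (Function.update s b (c :: s b))).trans (n₂ := 0) ?_)
    · simp only [TM2.step, call, stepAux]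
      rw [contentsWith_inr, contentsWith_update]
      have h1 : (haltList (M i).tm ((c :: y).map (M i).outputAlphabet.invFun)).stk
        (M i).tm.k₁ = (M i).outputAlphabet.symm c :: y.map (M i).outputAlphabet.symm := by
        simp [haltList]
      rw [h1, update_haltList, contentsWith_update_inl]
      simp [initVars, contentsWith]
    · simpa using Steps.refl _

/-- The phases are feeding, simulation and fetching. The halting configuration `haltList` has the
initial state and only the output stack nonempty; once this stack is emptied, the machine is ready
to be called again. -/
theorem call_runs (i : I) (a b : R) (s : R → Str) {w : Str} {t : ℕ}
    (h : Answers (M i) (s a).reverse w t) :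
    (call i a b : Prog M R).Runs s
      (Function.update (Function.update s a []) b (w.reverse ++ Function.update s a [] b))
      ((s a).length + t + w.length + 2) := by
  obtain ⟨h⟩ := h
  have hs : Steps (M i).tm.m _ _ _ := steps_iff_iterate.2 h.evals_in_steps
  -- A halted configuration of the called machine corresponds to the label `fetch`.
  have key : ∀ c c' n, Steps (M i).tm.m c c' n → ∀ s : R → Str, Steps (call i a b : Prog M R).code
      ⟨some (c.l.elim .fetch .run), varsWith i c.var, contentsWith s i c.stk⟩
      ⟨some (c'.l.elim .fetch .run), varsWith i c'.var, contentsWith s i c'.stk⟩ n := by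
    intro c c' n h s
    induction h with
    | refl c => exact .refl _
    | @head c c₁ c' n h hs ih =>
      refine .head ?_ ih
      obtain ⟨l, v, S⟩ := c
      cases l with
      | none => cases h
      | some l =>
        obtain rfl := Option.some.inj h
        exact congrArg some (stepAux_embed i _ _ _ _ _ _)
  have h2 := key _ _ _ hs (Function.update s a [])
  have h1 := call_feed (M := M) i a b (s a) [] s rfl
  have h3 := call_fetch (M := M) i a b w (Function.update s a [])
  have h0 : (initList (M i).tm (([] : Str).map (M i).inputAlphabet.invFun)).stk = fun _ => [] := by
    funext k
    rcases eq_or_ne k (M i).tm.k₀ with rfl | h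
    · simp [initList]
    · simp [initList, h]
  rw [h0, contentsWith_nil, List.append_nil] at h1
  refine ⟨((s a).length + 1 + h.steps) + (w.length + 1), ?_, Steps.trans (h1.trans ?_) h3⟩
  · have : h.steps ≤ t := h.steps_le_m
    omega
  · have hv : varsWith i (initList (M i).tm
        ((s a).reverse.map (M i).inputAlphabet.invFun)).var = initVars M := varsWith_init i
    have hv' : varsWith i (haltList (M i).tm
        (w.map (M i).outputAlphabet.invFun)).var = initVars M := varsWith_init i
    rw [hv, hv'] at h2
    exact h2

/-! ### Programs and polynomial time -/

/-- A program as a machine with input register `a` and output register `b`. -/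
def Prog.toFinTM2 [Fintype R] [Fintype I] (P : Prog M R) (a b : R) : FinTM2 where
  K := Stacks M R
  kFin := letI := fun i => (M i).tm.kFin; inferInstance
  k₀ := .inl a
  k₁ := .inl b
  Γ := Alphabet M R
  Λ := P.Λ
  main := P.entry
  σ := Vars M
  initialState := initVars M
  σFin := letI := fun i => (M i).tm.σFin; inferInstance
  Γk₀Fin := inferInstanceAs (Fintype Bool)
  m := P.code

/-- Initial and halting configurations of the machine are exactly those in which one register is
filled and all else is empty. This is why a program must clear its working registers before it ends.
-/
theorem polyTime_of_runs [Fintype R] [Fintype I] {α β : Type} {ea : α → Str} {eb : β → Str}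
    {f : α → β} (P : Prog M R) (a b : R) (T : Polynomial ℕ)
    (h : ∀ x, P.Runs (Function.update (fun _ => []) a (ea x))
      (Function.update (fun _ => []) b (eb (f x))) (T.eval (ea x).length)) :
    PolyTime ea eb f := by
  have hi : ∀ w : Str, initList (P.toFinTM2 a b) w =
      ⟨some P.entry, initVars M, contents M (Function.update (fun _ => []) a w)⟩ := by
    intro w
    rw [← update_contents]
    refine congrArg (Cfg.mk _ _) ?_
    funext k
    rcases eq_or_ne k (Sum.inl a) with rfl | h
    · rw [Function.update_self]
      exact dif_pos rfl
    · refine Eq.trans ?_ (Function.update_of_ne h _ (contents M fun _ => [])).symm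
      rcases k with r | k <;> exact dif_neg h
  have ho : ∀ w : Str, haltList (P.toFinTM2 a b) w =
      ⟨none, initVars M, contents M (Function.update (fun _ => []) b w)⟩ := by
    intro w
    rw [← update_contents]
    refine congrArg (Cfg.mk _ _) ?_
    funext k
    rcases eq_or_ne k (Sum.inl b) with rfl | h
    · rw [Function.update_self]
      exact dif_pos rfl
    · refine Eq.trans ?_ (Function.update_of_ne h _ (contents M fun _ => [])).symm
      rcases k with r | k <;> exact dif_neg h
  refine ⟨⟨P.toFinTM2 a b, Equiv.refl Bool, Equiv.refl Bool⟩, T, fun x => ?_⟩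
  refine ⟨⟨(h x).choose, ?_⟩, (h x).choose_spec.1⟩
  have hi' : initList (P.toFinTM2 a b) ((ea x).map (Equiv.refl Bool).invFun) = _ :=
    (congrArg (initList (P.toFinTM2 a b)) (List.map_id (ea x))).trans (hi _)
  have ho' : haltList (P.toFinTM2 a b) ((eb (f x)).map (Equiv.refl Bool).invFun) = _ :=
    (congrArg (haltList (P.toFinTM2 a b)) (List.map_id (eb (f x)))).trans (ho _)
  exact (congrArg (fun c => (flip bind (TM2.step P.code))^[(h x).choose] (some c)) hi').trans
    ((steps_iff_iterate.1 (h x).choose_spec.2).trans (congrArg some ho').symm)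

/-- One polynomial serves for both time and output length. Only codes of elements of `α` are
covered, so the composition may be called only on groups with a common parameter value. -/
theorem PolyTime.exists_oracle {α β : Type} {ea : α → Str} {eb : β → Str} {f : α → β}
    (h : PolyTime ea eb f) : ∃ (M : TM2ComputableAux Bool Bool) (p : Polynomial ℕ),
      ∀ x, Answers M (ea x) (eb (f x)) (p.eval (ea x).length) ∧
        (eb (f x)).length ≤ p.eval (ea x).length := by
  obtain ⟨h⟩ := h
  obtain ⟨C, hC⟩ := exists_answers_length_le h.toTM2ComputableAux
  -- The output is at most the input length plus `C` times the running time; the summand `1` makes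
  -- room for the running time itself.
  refine ⟨h.toTM2ComputableAux, .X + h.time * (Polynomial.C C + 1), fun x => ?_⟩
  have hx : Answers h.toTM2ComputableAux (ea x) (eb (f x)) (h.time.eval (ea x).length) :=
    ⟨h.outputsFun x⟩
  have := hC _ _ _ hx
  have hp : (Polynomial.X + h.time * (Polynomial.C C + 1)).eval (ea x).length =
      (ea x).length + h.time.eval (ea x).length * C + h.time.eval (ea x).length := by
    simp [mul_add, add_assoc]
  rw [hp]
  refine ⟨?_, by omega⟩
  obtain ⟨hx⟩ := hx
  exact ⟨⟨hx.toEvalsTo, hx.steps_le_m.trans (by omega)⟩⟩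

end Program

/-! ### Disjoint union of circuits -/

/-- The values of the gates `gs`, appended to the values `v` of the gates before them. -/
def evalGates {n : ℕ} (a : Fin n → Bool) (v : List Bool) (gs : List (Gate n)) : List Bool :=
  gs.foldl (fun v g => v ++ [g.eval a v]) v

/-- Rename the inputs of a gate by `f`, and move its other references by `s`. -/
def Gate.shift {m n : ℕ} (f : Fin m → Fin n) (s : ℕ) : Gate m → Gate n
  | .input i => .input (f i)
  | .const b => .const b
  | .not j => .not (s + j)
  | .and j k => .and (s + j) (s + k)
  | .or j k => .or (s + j) (s + k)

/-- Shifted references skip `u`. No bound on the references is required, since `getD` returns the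
same default on both sides for positions past the end. -/
theorem Gate.eval_shift {m n : ℕ} {f : Fin m → Fin n} {a : Fin m → Bool} {a' : Fin n → Bool}
    (h : ∀ i, a' (f i) = a i) (u v : List Bool) (g : Gate m) :
    (g.shift f u.length).eval a' (u ++ v) = g.eval a v := by
  have key : ∀ j, (u ++ v).getD (u.length + j) false = v.getD j false := fun j => by
    rw [List.getD_append_right _ _ _ _ (Nat.le_add_right _ _), Nat.add_sub_cancel_left]
  cases g <;> simp only [Gate.shift, Gate.eval, h, key]

theorem evalGates_shift {m n : ℕ} {f : Fin m → Fin n} {a : Fin m → Bool} {a' : Fin n → Bool}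
    (h : ∀ i, a' (f i) = a i) (u v : List Bool) (gs : List (Gate m)) :
    evalGates a' (u ++ v) (gs.map (Gate.shift f u.length)) = u ++ evalGates a v gs := by
  induction gs generalizing v with
  | nil => rfl
  | cons g gs ih =>
    simp only [evalGates, List.map_cons, List.foldl_cons] at ih ⊢
    rw [Gate.eval_shift h, List.append_assoc, ih]

theorem length_evalGates {n : ℕ} (a : Fin n → Bool) (v : List Bool) (gs : List (Gate n)) :
    (evalGates a v gs).length = v.length + gs.length := by
  induction gs generalizing v with
  | nil => rfl
  | cons g gs ih =>
    simp only [evalGates, List.foldl_cons, List.length_cons] at ih ⊢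
    rw [ih]
    simp
    omega

theorem Gate.below_shift {m n : ℕ} (f : Fin m → Fin n) (s l : ℕ) {g : Gate m} (h : g.Below l) :
    (g.shift f s).Below (s + l) := by
  cases g <;> simp_all [Gate.shift, Gate.Below]

/-- The conjunction (if `o`) or disjunction of two gates. -/
def Gate.junction {n : ℕ} (o : Bool) (j k : ℕ) : Gate n := if o then .and j k else .or j k

namespace CircuitInstance

/-- The instance whose circuit is the conjunction (if `o`) or disjunction of two circuits. -/
def merge (o : Bool) (c d : CircuitInstance) : CircuitInstance where
  strings := c.strings ++ d.strings
  circuit :=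
    { gates := c.circuit.gates.map (Gate.shift (fun i => ⟨i, by simp; omega⟩) 0) ++
        (d.circuit.gates.map
          (Gate.shift (fun i => ⟨c.strings.length + i, by simp⟩) c.circuit.size) ++
        -- These are the positions of the two former output gates.
        [Gate.junction o (c.circuit.size - 1) (c.circuit.size + d.circuit.size - 1)])
      gates_ne_nil := by simp
      below := by
        intro i h
        have hc := List.length_pos_of_ne_nil c.circuit.gates_ne_nil
        have hd := List.length_pos_of_ne_nil d.circuit.gates_ne_nil
        simp only [List.length_append, List.length_map, List.length_singleton] at h
        rcases lt_or_ge i c.circuit.gates.length with h1 | h1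
        · rw [List.getElem_append_left (by simpa using h1), List.getElem_map]
          simpa using Gate.below_shift _ 0 i (c.circuit.below i h1)
        rw [List.getElem_append_right (by simpa using h1)]
        rcases lt_or_ge i (c.circuit.gates.length + d.circuit.gates.length) with h2 | h2
        · rw [List.getElem_append_left (by simp only [List.length_map]; omega), List.getElem_map]
          have := Gate.below_shift (fun i : Fin d.strings.length =>
            (⟨c.strings.length + i, by simp⟩ : Fin (c.strings ++ d.strings).length))
            c.circuit.size _ (d.circuit.below (i - c.circuit.gates.length) (by omega))
          have hi : c.circuit.size + (i - c.circuit.gates.length) = i := by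
            rw [Circuit.size]; omega
          rw [hi] at this
          simpa using this
        · rw [List.getElem_append_right (by simp only [List.length_map]; omega),
            List.getElem_singleton]
          rw [Circuit.size, Circuit.size]
          cases o
          · exact ⟨by omega, by omega⟩
          · exact ⟨by omega, by omega⟩ }

/-- The instance without strings whose circuit has the constant value `o`. -/
def const (o : Bool) : CircuitInstance where
  strings := []
  circuit :=
    { gates := [.const o]
      gates_ne_nil := by simp
      below := by simp [Gate.Below] }

theorem accepts_const {o : Bool} {X : Set Str} : (const o).Accepts X ↔ o = true := by
  simp [Accepts, const, Circuit.eval, Circuit.values, Gate.eval]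

theorem size_merge (o : Bool) (c d : CircuitInstance) :
    (merge o c d).circuit.size = c.circuit.size + d.circuit.size + 1 := by
  simp [merge, Circuit.size, add_assoc]

theorem accepts_merge {o : Bool} {c d : CircuitInstance} {X : Set Str} :
    (merge o c d).Accepts X ↔
      if o then c.Accepts X ∧ d.Accepts X else c.Accepts X ∨ d.Accepts X := by
  classical
  have hc := List.length_pos_of_ne_nil c.circuit.gates_ne_nil
  have hd := List.length_pos_of_ne_nil d.circuit.gates_ne_nil
  set a : Fin c.strings.length → Bool := fun i => decide (c.strings.get i ∈ X)
  set b : Fin d.strings.length → Bool := fun i => decide (d.strings.get i ∈ X)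
  set a' : Fin (merge o c d).strings.length → Bool :=
    fun i => decide ((merge o c d).strings.get i ∈ X) with ha'
  have h1 : ∀ i : Fin c.strings.length, a' ⟨i, by simp [merge]; omega⟩ = a i := by
    intro i
    simp [a', a, merge]
  have h2 : ∀ i : Fin d.strings.length, a' ⟨c.strings.length + i, by simp [merge]⟩ = b i := by
    intro i
    simp [a', b, merge]
  have e1 := evalGates_shift (a' := a') h1 [] [] c.circuit.gates
  simp only [List.nil_append, List.length_nil] at e1
  have lc : (evalGates a [] c.circuit.gates).length = c.circuit.size := by
    simp [length_evalGates, Circuit.size]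
  have ld : (evalGates b [] d.circuit.gates).length = d.circuit.size := by
    simp [length_evalGates, Circuit.size]
  have e2 := evalGates_shift (a' := a') h2 (evalGates a [] c.circuit.gates) [] d.circuit.gates
  rw [lc, List.append_nil] at e2
  have e : (merge o c d).circuit.values a' =
      let v := evalGates a [] c.circuit.gates ++ evalGates b [] d.circuit.gates
      v ++ [(Gate.junction o (c.circuit.size - 1)
        (c.circuit.size + d.circuit.size - 1)).eval a' v] := by
    have : (merge o c d).circuit.values a' = evalGates a' (evalGates a' (evalGates a' []
      (c.circuit.gates.map (Gate.shift (fun i => ⟨i, by simp [merge]; omega⟩) 0)))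
      (d.circuit.gates.map
          (Gate.shift (fun i => ⟨c.strings.length + i, by simp [merge]⟩) c.circuit.size)))
      [Gate.junction o (c.circuit.size - 1) (c.circuit.size + d.circuit.size - 1)] := by
      simp only [Circuit.values, merge, List.foldl_append, evalGates]
    rw [this, e1, e2]
    rfl
  -- The last value of a nonempty circuit stands at position `size - 1`; appending further values
  -- does not affect it.
  have ec : c.circuit.eval a =
      (evalGates a [] c.circuit.gates ++ evalGates b [] d.circuit.gates).getD
        (c.circuit.size - 1) false := by
    rw [List.getD_append _ _ _ _ (by rw [lc]; simp only [Circuit.size]; omega), ← lc]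
    simp [Circuit.eval, Circuit.values, evalGates, List.getLastD_eq_getLast?,
      List.getLast?_eq_getElem?]
  have ed : d.circuit.eval b =
      (evalGates a [] c.circuit.gates ++ evalGates b [] d.circuit.gates).getD
        (c.circuit.size + d.circuit.size - 1) false := by
    rw [List.getD_append_right _ _ _ _ (by rw [lc]; simp only [Circuit.size]; omega), lc]
    have : c.circuit.size + d.circuit.size - 1 - c.circuit.size = d.circuit.size - 1 := by omega
    rw [this, ← ld]
    simp [Circuit.eval, Circuit.values, evalGates, List.getLastD_eq_getLast?,
      List.getLast?_eq_getElem?]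
  have em : (merge o c d).circuit.eval a' =
      if o then c.circuit.eval a && d.circuit.eval b else c.circuit.eval a || d.circuit.eval b := by
    rw [Circuit.eval, e, ec, ed]
    cases o <;> simp [Gate.junction, Gate.eval]
  have hm : (merge o c d).Accepts X ↔ (merge o c d).circuit.eval a' = true := by
    rw [Accepts, ha']
  have hcc : c.Accepts X ↔ c.circuit.eval a = true := Iff.rfl
  have hdd : d.Accepts X ↔ d.circuit.eval b = true := Iff.rfl
  rw [hm, hcc, hdd, em]
  cases o <;> simp

end CircuitInstance

/-! ### Codes of merged circuits, and lengths of codes -/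

theorem encodeUnary_add (m n : ℕ) :
    encodeUnary (m + n) = List.replicate m true ++ encodeUnary n := by
  induction m with
  | zero => simp
  | succ m ih => rw [Nat.succ_add, encodeUnary, ih]; rfl

theorem length_encodeUnary (n : ℕ) : (encodeUnary n).length = n + 1 := by
  induction n with
  | zero => rfl
  | succ n ih => simp [encodeUnary, ih]

theorem length_encodeStr (x : Str) : (encodeStr x).length = 2 * x.length + 1 := by
  induction x with
  | nil => rfl
  | cons b x ih => simp [encodeStr, ih]; omega

theorem encodeSeq_cons (x : Str) (xs : List Str) :
    encodeSeq (x :: xs) = encodeStr x ++ encodeSeq xs := rfl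

theorem encodeSeq_append (xs ys : List Str) :
    encodeSeq (xs ++ ys) = encodeSeq xs ++ encodeSeq ys := by
  simp [encodeSeq]

theorem Gate.encode_shift_zero {m n : ℕ} {f : Fin m → Fin n} (hf : ∀ i, (f i : ℕ) = i)
    (g : Gate m) : (g.shift f 0).encode = g.encode := by
  cases g <;> simp [Gate.shift, Gate.encode, hf]

theorem Gate.length_encode_pos {n : ℕ} (g : Gate n) : 0 < g.encode.length := by
  cases g <;> simp [Gate.encode, length_encodeUnary]

/-- The code of the first circuit stays a prefix, so merging only appends bits to what is already
written. Codes of gates do not show the number of inputs; hence the junction may be taken with `n :=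
0`. -/
theorem CircuitInstance.encode_circuit_merge (o : Bool) (c d : CircuitInstance) :
    (merge o c d).circuit.encode = c.circuit.encode ++
      ((d.circuit.gates.map (Gate.shift (fun i =>
        (⟨c.strings.length + i, by simp⟩ : Fin (c.strings ++ d.strings).length))
        c.circuit.size)).flatMap Gate.encode ++
      (Gate.junction (n := 0) o (c.circuit.size - 1)
        (c.circuit.size + d.circuit.size - 1)).encode) := by
  simp only [Circuit.encode, merge, List.flatMap_append, List.flatMap_map, List.flatMap_singleton]
  congr 1
  · exact congrArg (List.flatMap · _) (funext fun g => by
      apply Gate.encode_shift_zero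
      exact fun _ => rfl)
  · congr 1
    cases o <;> rfl

theorem length_flatMap_le {α β : Type} {f : α → List β} {l : List α} {B : ℕ}
    (h : ∀ x ∈ l, (f x).length ≤ B) : (l.flatMap f).length ≤ l.length * B := by
  induction l with
  | nil => simp
  | cons x l ih =>
    simp only [List.flatMap_cons, List.length_append, List.length_cons, Nat.succ_mul]
    have := h x (by simp)
    have := ih fun y hy => h y (by simp [hy])
    omega

/-- Unary references are short because they point to earlier gates. -/
theorem Gate.length_encode_le {n l : ℕ} {g : Gate n} (h : g.Below l) :
    g.encode.length ≤ 7 + n + 2 * l := by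
  cases g <;> simp [Gate.Below, Gate.encode, length_encodeUnary] at h ⊢ <;> omega

theorem Circuit.length_encode_le {n : ℕ} (φ : Circuit n) :
    φ.encode.length ≤ φ.size * (7 + n + 2 * φ.size) := by
  refine length_flatMap_le fun g hg => ?_
  obtain ⟨i, hi, rfl⟩ := List.getElem_of_mem hg
  refine (Gate.length_encode_le (φ.below i hi)).trans ?_
  simp only [Circuit.size]
  omega

theorem CircuitInstance.length_encode_le {c : CircuitInstance} {l m n : ℕ}
    (hl : c.strings.length ≤ l) (hm : ∀ q ∈ c.strings, q.length ≤ m) (hn : c.circuit.size ≤ n) :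
    c.encode.length ≤ 2 * (n * (7 + l + 2 * n)) + 1 + l * (2 * m + 1) := by
  rw [CircuitInstance.encode, encodeSeq_cons, List.length_append, length_encodeStr]
  have h1 := c.circuit.length_encode_le
  have h2 : c.circuit.size * (7 + c.strings.length + 2 * c.circuit.size) ≤
      n * (7 + l + 2 * n) := by gcongr
  have h3 : (encodeSeq c.strings).length ≤ c.strings.length * (2 * m + 1) :=
    length_flatMap_le fun q hq => by
      have := hm q hq
      rw [length_encodeStr]
      omega
  have h4 : c.strings.length * (2 * m + 1) ≤ l * (2 * m + 1) := by gcongr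
  omega

theorem Circuit.size_le_length_encode {n : ℕ} (φ : Circuit n) : φ.size ≤ φ.encode.length := by
  rw [Circuit.size, Circuit.encode]
  induction φ.gates with
  | nil => simp
  | cons g gs ih =>
    have := g.length_encode_pos
    simp only [List.length_cons, List.flatMap_cons, List.length_append]
    omega

theorem length_le_length_encodeSeq_of_mem {xs : List Str} {x : Str} (h : x ∈ xs) :
    x.length ≤ (encodeSeq xs).length := by
  induction xs with
  | nil => cases h
  | cons y xs ih =>
    rw [encodeSeq_cons, List.length_append, length_encodeStr]
    rcases List.mem_cons.1 h with rfl | h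
    · omega
    · have := ih h
      omega

theorem length_le_length_encodeSeq (xs : List Str) : xs.length ≤ (encodeSeq xs).length := by
  induction xs with
  | nil => simp
  | cons y xs ih =>
    rw [encodeSeq_cons, List.length_append, length_encodeStr, List.length_cons]
    omega

theorem length_encodeSeq_filter_le (p : Str → Bool) (xs : List Str) :
    (encodeSeq (xs.filter p)).length ≤ (encodeSeq xs).length :=
  (List.filter_sublist.flatMap _).length_le

theorem length_le_maxLength {xs : List Str} {x : Str} (h : x ∈ xs) : x.length ≤ maxLength xs := by
  induction xs with
  | nil => cases h
  | cons y xs ih =>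
    rcases List.mem_cons.1 h with rfl | h
    · exact le_max_left _ _
    · exact (ih h).trans (le_max_right _ _)

theorem maxLength_le_length_encodeSeq (xs : List Str) :
    maxLength xs ≤ (encodeSeq xs).length := by
  induction xs with
  | nil => exact Nat.zero_le _
  | cons x xs ih =>
    rw [encodeSeq_cons, List.length_append, length_encodeStr]
    exact max_le (by omega) (ih.trans (by omega))

/-! ### Conjunctions and disjunctions of membership statements -/

/-- All members of the list (if `o`), or some member, lie in `X`. -/
def Holds (o : Bool) (X : Set Str) (xs : List Str) : Prop :=
  if o then ∀ x ∈ xs, x ∈ X else ∃ x ∈ xs, x ∈ X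

/-- Splits off the group of the head `x`. Keeping `x` outside the filter makes the group visibly
nonempty, as the composition demands. -/
theorem holds_cons_filter {o : Bool} {X : Set Str} {x : Str} {xs : List Str} {p : Str → Bool} :
    Holds o X (x :: xs) ↔
      if o then Holds o X (x :: xs.filter p) ∧ Holds o X (xs.filter fun y => !p y)
      else Holds o X (x :: xs.filter p) ∨ Holds o X (xs.filter fun y => !p y) := by
  cases o
  · simp only [Holds, Bool.false_eq_true, if_false, List.mem_cons, List.mem_filter]
    constructor
    · rintro ⟨y, rfl | hy, hX⟩
      · exact .inl ⟨y, .inl rfl, hX⟩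
      · cases hp : p y
        · exact .inr ⟨y, ⟨hy, by simp [hp]⟩, hX⟩
        · exact .inl ⟨y, .inr ⟨hy, hp⟩, hX⟩
    · rintro (⟨y, rfl | hy, hX⟩ | ⟨y, hy, hX⟩)
      · exact ⟨y, .inl rfl, hX⟩
      · exact ⟨y, .inr hy.1, hX⟩
      · exact ⟨y, .inr hy.1, hX⟩
  · simp only [Holds, if_true, List.mem_cons, List.mem_filter]
    constructor
    · intro h
      exact ⟨fun y hy => h y (hy.imp_right And.left), fun y hy => h y (.inr hy.1)⟩
    · rintro ⟨h1, h2⟩ y (rfl | hy)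
      · exact h1 y (.inl rfl)
      · cases hp : p y
        · exact h2 y ⟨hy, by simp [hp]⟩
        · exact h1 y (.inr ⟨hy, hp⟩)

/-- The value `κ x` no longer occurs. This is the measure that bounds the number of rounds. -/
theorem card_image_filter_lt {κ : Str → ℕ} (x : Str) (xs : List Str) :
    ((xs.filter fun y => !decide (κ y = κ x)).map κ).toFinset.card <
      ((x :: xs).map κ).toFinset.card := by
  refine Finset.card_lt_card ⟨?_, ?_⟩
  · intro k
    simp only [List.mem_toFinset, List.mem_map, List.mem_filter, List.mem_cons]
    rintro ⟨y, hy, rfl⟩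
    exact ⟨y, .inr hy.1, rfl⟩
  · intro h
    have := h (show κ x ∈ _ by simp)
    obtain ⟨_, ⟨_, h1⟩, h2⟩ : ∃ a, (a ∈ xs ∧ ¬κ a = κ x) ∧ κ a = κ x := by simpa using this
    exact h1 h2

/-- Number of positions of the first string in which the second one differs from it. -/
def mismatches : Str → Str → ℕ
  | [], _ => 0
  | b :: u, v => (if v.head? = some b then 0 else 1) + mismatches u v.tail

/-- `mismatches` notices differing bits and a `v` that is too short; the remaining term notices a
`v` that is too long. -/
theorem mismatches_add_eq_zero {u v : Str} :
    mismatches u v + (v.drop u.length).length = 0 ↔ u = v := by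
  induction u generalizing v with
  | nil => cases v <;> simp [mismatches]
  | cons b u ih =>
    cases v with
    | nil => simp [mismatches]
    | cons c v =>
      rw [List.cons.injEq, ← ih]
      by_cases h : c = b
      · simp [mismatches, h]
      · simp [mismatches, h, Ne.symm h]

theorem mismatches_le (u v : Str) : mismatches u v ≤ u.length := by
  induction u generalizing v with
  | nil => simp [mismatches]
  | cons b u ih =>
    have := ih v.tail
    simp only [mismatches, List.length_cons]
    split_ifs <;> omega

theorem replicate_append_cons (n : ℕ) (b : Bool) (l : Str) :
    List.replicate n b ++ b :: l = b :: (List.replicate n b ++ l) := by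
  induction n with
  | zero => rfl
  | succ n ih => rw [List.replicate_succ, List.cons_append, ih, List.cons_append]

theorem eval_mono (p : Polynomial ℕ) : Monotone fun n => p.eval n := by
  intro m n h
  simp only [Polynomial.eval_eq_sum, Polynomial.sum]
  gcongr

/-! ### Programs for strings in registers -/

section Registers

variable {I R : Type} {M : I → TM2ComputableAux Bool Bool} [DecidableEq I] [DecidableEq R]

open Function (update)

/-- Repeat a program as long as the register `r` is nonempty. -/
def whileNonempty (r : R) (P : Prog M R) : Prog M R :=
  popLoop r Option.isSome fun o => o.elim skip fun b => push r b ⨟ P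

theorem whileNonempty_nil {r : R} {P : Prog M R} {s : R → Str} (h : s r = []) :
    (whileNonempty r P).Runs s s 2 := by
  refine popLoop_exit (o := none) (by simp [h]) ((skip_runs _).congr ?_ le_rfl) rfl
  have : (s r).tail = s r := by rw [h]; rfl
  rw [this, Function.update_eq_self]

/-- The test pops a bit and pushes it back, so `P` starts in the state `s` itself; this accounts for
the two extra steps. -/
theorem whileNonempty_cons {r : R} {P : Prog M R} {s s' s'' : R → Str} {t t' : ℕ}
    (hr : s r ≠ []) (h : P.Runs s s' t) (h' : (whileNonempty r P).Runs s' s'' t') :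
    (whileNonempty r P).Runs s s'' (t + t' + 2) := by
  obtain ⟨b, l, hl⟩ := List.exists_cons_of_ne_nil hr
  refine (popLoop_again (o := some b) (by simp [hl]) (((push_runs _ _ _).congr ?_ le_rfl).seq h)
    rfl h').congr rfl (by omega)
  rw [Function.update_idem, Function.update_self, hl, List.tail_cons, ← hl,
    Function.update_eq_self]

/-- Empty the register `a`. -/
def clear (a : R) : Prog M R := popLoop a Option.isSome fun _ => skip

theorem clear_runs (a : R) (s : R → Str) :
    (clear a : Prog M R).Runs s (update s a []) (2 * (s a).length + 2) := by
  generalize hx : s a = x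
  induction x generalizing s with
  | nil =>
    exact popLoop_exit (o := none) (by simp [hx]) ((skip_runs _).congr (by simp [hx]) le_rfl) rfl
  | cons b x ih =>
    refine (popLoop_again (o := some b) (by simp [hx]) (skip_runs _) rfl
      (ih _ (by simp [hx]))).congr (by simp) ?_
    simp only [List.length_cons]
    omega

/-- Move the reversed contents of the register `a` to the register `b`. -/
def move (a b : R) : Prog M R := popLoop a Option.isSome fun o => o.elim skip (push b)

theorem move_runs {a b : R} (hab : a ≠ b) (s : R → Str) :
    (move a b : Prog M R).Runs s (update (update s a []) b ((s a).reverse ++ s b))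
      (2 * (s a).length + 2) := by
  generalize hx : s a = x
  induction x generalizing s with
  | nil =>
    refine popLoop_exit (o := none) (by simp [hx]) ((skip_runs _).congr ?_ le_rfl) rfl
    funext r
    simp only [Function.update_apply]
    split_ifs <;> simp_all
  | cons c x ih =>
    refine (popLoop_again (o := some c) (by simp [hx]) (push_runs _ _ _) rfl
      (ih _ (by simp [hx, hab]))).congr ?_ ?_
    · funext r
      simp only [Function.update_apply]
      split_ifs <;> simp_all
    · simp only [List.length_cons]
      omega

/-- Prepend the reversed contents of `a` to the register `b`, using the empty register `c`. -/
def copy (a b c : R) : Prog M R :=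
  popLoop a Option.isSome (fun o => o.elim skip fun v => push b v ⨟ push c v) ⨟ move c a

/-- Emptying `a` leaves reversed copies in `b` and `c`; moving the one in `c` back reverses it again
and restores `a`. -/
theorem copy_runs {a b c : R} (hab : a ≠ b) (hac : a ≠ c) (hbc : b ≠ c) {s : R → Str}
    (hc : s c = []) :
    (copy a b c : Prog M R).Runs s (update s b ((s a).reverse ++ s b))
      (5 * (s a).length + 4) := by
  have key : ∀ x (s : R → Str), s a = x →
      (popLoop a Option.isSome (fun o => o.elim skip fun v => push b v ⨟ push c v) :
        Prog M R).Runs s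
        (update (update (update s a []) b (x.reverse ++ s b)) c (x.reverse ++ s c))
        (3 * x.length + 2) := by
    intro x
    induction x with
    | nil =>
      intro s hx
      refine popLoop_exit (o := none) (by simp [hx]) ((skip_runs _).congr ?_ le_rfl) rfl
      funext r
      simp only [Function.update_apply]
      split_ifs <;> simp_all
    | cons v x ih =>
      intro s hx
      refine (popLoop_again (o := some v) (by simp [hx]) ((push_runs _ _ _).seq (push_runs _ _ _))
        rfl (ih _ (by simp [hx, hab, hac]))).congr ?_ ?_
      · funext r
        simp only [Function.update_apply]
        split_ifs <;> simp_all
      · simp only [List.length_cons]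
        omega
  refine ((key _ s rfl).seq (move_runs hac.symm _)).congr ?_ ?_
  · funext r
    simp only [Function.update_apply]
    split_ifs <;> simp_all
  · simp [hc]
    omega

/-- Push the bits of `w`, in order. -/
def pushStr (a : R) (w : Str) : Prog M R := w.foldr (fun b P => push a b ⨟ P) skip

theorem pushStr_runs (a : R) (w : Str) (s : R → Str) :
    (pushStr a w : Prog M R).Runs s (update s a (w.reverse ++ s a)) (w.length + 1) := by
  induction w generalizing s with
  | nil => exact (skip_runs s).congr (by simp) le_rfl
  | cons b w ih =>
    refine ((push_runs a b s).seq (ih _)).congr (by simp) ?_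
    simp only [List.length_cons]
    omega

/-- Read the code of a string from the register `a`. Push the bits of the string to `b`, and those
of its code to `c`. -/
def readStr (a b c : R) : Prog M R :=
  popLoop a (· == some true) fun o => o.elim skip fun v =>
    if v then popLoop a (fun _ => false) fun o => o.elim skip fun v =>
      push b v ⨟ push c true ⨟ push c v
    else push c false

/-- In the self-delimiting code `true` announces a bit and `false` ends the string, so the loop
repeats exactly after `true`. -/
theorem readStr_runs {a b c : R} (hab : a ≠ b) (hac : a ≠ c) (hbc : b ≠ c) {s : R → Str}
    {w l : Str} (h : s a = encodeStr w ++ l) :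
    (readStr a b c : Prog M R).Runs s
      (update (update (update s a l) b (w.reverse ++ s b)) c ((encodeStr w).reverse ++ s c))
      (5 * w.length + 2) := by
  induction w generalizing s with
  | nil =>
    refine (popLoop_exit (o := some false) (by simp [h, encodeStr]) (push_runs _ _ _) rfl).congr
      ?_ le_rfl
    funext r
    simp only [Function.update_apply]
    split_ifs <;> simp_all [encodeStr]
  | cons v w ih =>
    refine (popLoop_again (o := some true) (by simp [h, encodeStr])
      (popLoop_exit (o := some v) (by simp [h, encodeStr])
        ((push_runs _ _ _).seq ((push_runs _ _ _).seq (push_runs _ _ _))) rfl) rfl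
      (ih (by simp [h, encodeStr, hab, hac]))).congr ?_ ?_
    · funext r
      simp only [Function.update_apply]
      split_ifs <;> simp_all [encodeStr]
    · simp only [List.length_cons]
      omega

/-- Move the unary code of a number from the register `a` to the register `b`. -/
def readUnary (a b : R) : Prog M R :=
  popLoop a (· == some true) fun o => o.elim skip (push b)

theorem readUnary_runs {a b : R} (hab : a ≠ b) {s : R → Str} {n : ℕ} {l : Str}
    (h : s a = encodeUnary n ++ l) :
    (readUnary a b : Prog M R).Runs s
      (update (update s a l) b ((encodeUnary n).reverse ++ s b)) (2 * n + 2) := by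
  induction n generalizing s with
  | zero =>
    refine (popLoop_exit (o := some false) (by simp [h, encodeUnary]) (push_runs _ _ _) rfl).congr
      ?_ le_rfl
    funext r
    simp only [Function.update_apply]
    split_ifs <;> simp_all [encodeUnary]
  | succ n ih =>
    refine (popLoop_again (o := some true) (by simp [h, encodeUnary]) (push_runs _ _ _) rfl
      (ih (by simp [h, encodeUnary, hab]))).congr ?_ (by omega)
    funext r
    simp only [Function.update_apply]
    split_ifs <;> simp_all [encodeUnary]

/-- Move the unary code of a number from the register `a` to the register `b`, and choose the
program with this number. -/
def switchUnary (a b : R) : List (Prog M R) → Prog M R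
  | [] => skip
  | P :: Ps => popLoop a (fun _ => false) fun o => o.elim skip fun v =>
      if v then push b true ⨟ switchUnary a b Ps else push b false ⨟ P

theorem switchUnary_runs {a b : R} (hab : a ≠ b) {Ps : List (Prog M R)} {P : Prog M R}
    {s s' : R → Str} {n t : ℕ} {l : Str} (hP : Ps[n]? = some P) (h : s a = encodeUnary n ++ l)
    (hs : P.Runs (update (update s a l) b ((encodeUnary n).reverse ++ s b)) s' t) :
    (switchUnary a b Ps).Runs s s' (t + 2 * n + 2) := by
  induction Ps generalizing s n with
  | nil => simp at hP
  | cons Q Ps ih =>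
    cases n with
    | zero =>
      obtain rfl : Q = P := by simpa using hP
      refine (popLoop_exit (o := some false) (by simp [h, encodeUnary])
        (((push_runs _ _ _).congr ?_ le_rfl).seq hs) rfl).congr rfl (by omega)
      funext r
      simp only [Function.update_apply]
      split_ifs <;> simp_all [encodeUnary]
    | succ n =>
      have hs' : update (update s a l) b ((encodeUnary (n + 1)).reverse ++ s b) =
          update (update (update (update s a (s a).tail) b (true :: update s a (s a).tail b)) a l) b
            ((encodeUnary n).reverse ++
              update (update s a (s a).tail) b (true :: update s a (s a).tail b) b) := by
        funext r
        simp only [Function.update_apply]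
        split_ifs <;> simp_all [encodeUnary]
      rw [hs'] at hs
      exact (popLoop_exit (o := some true) (by simp [h, encodeUnary])
        ((push_runs _ _ _).seq (ih (by simpa using hP) (by simp [h, encodeUnary, hab]) hs))
        rfl).congr rfl (by omega)

end Registers

/-! ### The distillation program -/

section Distillation

/-- The machines that the distillation calls: for the parameterization, the composition, and the
kernelization. -/
inductive Oracle
  | param
  | comp
  | kern
  deriving DecidableEq

instance : Fintype Oracle := ⟨{.param, .comp, .kern}, fun i => by cases i <;> decide⟩

/-- The registers of the distillation. -/
inductive Reg
  | inp
  | out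
  | word
  | code
  | key
  | key'
  | flag
  | grp
  | rest
  | tmp
  | ans
  | ker
  | circ
  | inputs
  | last
  | count
  | acc
  | strs
  deriving DecidableEq

instance : Fintype Reg :=
  ⟨{.inp, .out, .word, .code, .key, .key', .flag, .grp, .rest, .tmp, .ans, .ker, .circ, .inputs,
    .last, .count, .acc, .strs}, fun r => by cases r <;> decide⟩

open Function (update)
open Reg

variable {M : Oracle → TM2ComputableAux Bool Bool}

/-- Compare the registers `key` and `key'`, and empty the latter. Push to `flag` if they differ. -/
def compareKeys : Prog M Reg :=
  popLoop key Option.isSome (fun o => o.elim skip fun b =>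
    push tmp b ⨟ popLoop key' (fun _ => false) fun o' =>
      if o' = some b then skip else push flag true) ⨟
  popLoop key' Option.isSome (fun o => o.elim skip fun _ => push flag true) ⨟
  move tmp key

/-- `key` is consumed bit by bit against `key'` while being saved in `tmp`; then the excess of
`key'` is counted and `key` is restored. If `flag` was empty, it stays empty exactly when the keys
agree. -/
theorem compareKeys_runs {s : Reg → Str} (h : s tmp = []) :
    (compareKeys : Prog M Reg).Runs s
      (update (update s key' []) flag (List.replicate
        (mismatches (s key) (s key') + ((s key').drop (s key).length).length) true ++ s flag))
      (6 * (s key).length + 2 * (s key').length + 6) := by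
  have h1 : ∀ x (s : Reg → Str), s key = x →
      (popLoop key Option.isSome (fun o => o.elim skip fun b =>
        push tmp b ⨟ popLoop key' (fun _ => false) fun o' =>
          if o' = some b then skip else push flag true) : Prog M Reg).Runs s
        (update (update (update (update s key []) tmp (x.reverse ++ s tmp))
          key' ((s key').drop x.length)) flag
            (List.replicate (mismatches x (s key')) true ++ s flag))
        (4 * x.length + 2) := by
    intro x
    induction x with
    | nil =>
      intro s hx
      refine popLoop_exit (o := none) (by simp [hx]) ((skip_runs _).congr ?_ le_rfl) rfl
      funext r
      cases r <;> simp [hx, mismatches]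
    | cons b x ih =>
      intro s hx
      by_cases hb : (s key').head? = some b
      · refine (popLoop_again (o := some b) (by simp [hx]) ((push_runs _ _ _).seq
          (popLoop_exit (o := some b) (by simp [hb]) (t := 1)
            (s' := update (update (update s key x) tmp (b :: s tmp)) key' (s key').tail)
            ?_ rfl))
          rfl (ih _ (by simp))).congr ?_ ?_
        · rw [if_pos rfl]
          refine (skip_runs _).congr ?_ le_rfl
          funext r
          cases r <;> simp [hx]
        · funext r
          cases r <;> simp [mismatches, hb]
        · simp only [List.length_cons]
          omega
      · refine (popLoop_again (o := some b) (by simp [hx]) ((push_runs _ _ _).seq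
          (popLoop_exit rfl (t := 1) (s' := update (update (update (update s key x) tmp (b :: s tmp))
            key' (s key').tail) flag (true :: s flag)) ?_ rfl)) rfl
          (ih _ (by simp))).congr ?_ ?_
        · rw [if_neg (by simpa using hb)]
          refine (push_runs _ _ _).congr ?_ le_rfl
          funext r
          cases r <;> simp [hx]
        · funext r
          cases r <;> simp [mismatches, hb, replicate_append_cons, Nat.add_comm 1,
            List.replicate_succ]
        · simp only [List.length_cons]
          omega
  have h2 : ∀ x (s : Reg → Str), s key' = x →
      (popLoop key' Option.isSome (fun o => o.elim skip fun _ => push flag true) :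
        Prog M Reg).Runs s
        (update (update s key' []) flag (List.replicate x.length true ++ s flag))
        (2 * x.length + 2) := by
    intro x
    induction x with
    | nil =>
      intro s hx
      refine popLoop_exit (o := none) (by simp [hx]) ((skip_runs _).congr ?_ le_rfl) rfl
      funext r
      cases r <;> simp [hx]
    | cons b x ih =>
      intro s hx
      refine (popLoop_again (o := some b) (by simp [hx]) (push_runs _ _ _) rfl
          (ih _ (by simp [hx]))).congr ?_ ?_
      · funext r
        cases r <;> simp [replicate_append_cons, List.replicate_succ]
      · simp only [List.length_cons]
        omega
  refine ((h1 _ s rfl).seq ((h2 _ _ rfl).seq (move_runs (by decide) _))).congr ?_ ?_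
  · funext r
    cases r
    case flag =>
      rw [Nat.add_comm, List.replicate_add, List.append_assoc]
      simp
    all_goals simp [h]
  · simp [h]
    omega

/-- Read a reference to a gate of the new circuit from `circ`, and write the corresponding reference
for the combined circuit to `acc`. -/
def reference : Prog M Reg := copy last acc tmp ⨟ push acc true ⨟ readUnary circ acc

/-- In unary, adding `p + 1` means prefixing that many ones. Here `p + 1` will be the size of the
stored circuit; `last` holds `p`, the position of its output gate, since the junction gate needs
that number too. -/
theorem reference_runs {s : Reg → Str} {j p : ℕ} {l : Str} (ht : s tmp = [])
    (hp : s last = List.replicate p true) (hc : s circ = encodeUnary j ++ l) :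
    (reference : Prog M Reg).Runs s
      (update (update s circ l) acc ((encodeUnary (p + 1 + j)).reverse ++ s acc))
      (5 * p + 2 * j + 7) := by
  refine ((copy_runs (by decide) (by decide) (by decide) ht).seq ((push_runs _ _ _).seq
    (readUnary_runs (n := j) (l := l) (by decide) (by simp [hc])))).congr ?_ ?_
  · funext r
    cases r <;> simp [hp, encodeUnary_add, List.replicate_succ, replicate_append_cons]
  · simp [hp]
    omega

/-- Read a gate from `circ`, and write it to `acc`. -/
def readGate : Prog M Reg :=
  switchUnary circ acc [copy inputs acc tmp ⨟ readUnary circ acc,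
    popLoop circ (fun _ => false) fun o => o.elim skip (push acc),
    reference, reference ⨟ reference, reference ⨟ reference] ⨟ push count true

theorem readGate_runs {s : Reg → Str} {a p m n : ℕ} {l : Str} {g : Gate m} {f : Fin m → Fin n}
    (hf : ∀ i, (f i : ℕ) = a + i) (ht : s tmp = []) (ha : s inputs = List.replicate a true)
    (hp : s last = List.replicate p true) (hc : s circ = g.encode ++ l) :
    (readGate : Prog M Reg).Runs s
      (update (update (update s circ l) acc ((g.shift f (p + 1)).encode.reverse ++ s acc))
        count (true :: s count))
      (2 * g.encode.length + 5 * a + 10 * p + 20) := by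
  have key : ∀ {t : ℕ},
      (switchUnary circ acc [copy inputs acc tmp ⨟ readUnary circ acc,
        popLoop circ (fun _ => false) fun o => o.elim skip (push acc),
        reference, reference ⨟ reference, reference ⨟ reference] : Prog M Reg).Runs s
        (update (update s circ l) acc ((g.shift f (p + 1)).encode.reverse ++ s acc)) t →
      t + 1 ≤ 2 * g.encode.length + 5 * a + 10 * p + 20 →
      (readGate : Prog M Reg).Runs s
        (update (update (update s circ l) acc ((g.shift f (p + 1)).encode.reverse ++ s acc))
        count (true :: s count))
      (2 * g.encode.length + 5 * a + 10 * p + 20) := by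
    intro t h ht
    refine (h.seq (push_runs _ _ _)).congr ?_ ht
    simp
  -- Stated for arbitrary registers, because it is applied after the dispatch on the gate kind has
  -- changed them.
  have two : ∀ {s : Reg → Str} {j k : ℕ}, s tmp = [] → s last = List.replicate p true →
      s circ = encodeUnary j ++ (encodeUnary k ++ l) →
      (reference ⨟ reference : Prog M Reg).Runs s
      (update (update s circ l) acc ((encodeUnary (p + 1 + k)).reverse ++
        ((encodeUnary (p + 1 + j)).reverse ++ s acc)))
      (10 * p + 2 * j + 2 * k + 14) := by
    intro s j k ht hp hc
    refine ((reference_runs ht hp hc).seq (reference_runs (j := k) (l := l) (p := p)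
      (by simp [ht]) (by simp [hp]) (by simp))).congr ?_ (by omega)
    funext r
    cases r <;> simp
  cases g with
  | input i =>
    refine key (switchUnary_runs (by decide) (n := 0) rfl
      (by rw [hc, Gate.encode, List.append_assoc]) (((copy_runs (by decide) (by decide) (by decide)
        (by simp [ht])).seq (readUnary_runs (n := i) (l := l) (by decide) (by simp))).congr
        ?_ le_rfl)) ?_
    · funext r
      cases r <;> simp [Gate.shift, Gate.encode, hf, encodeUnary_add, ha]
    · simp [Gate.encode, length_encodeUnary, ha]
      omega
  | const b =>
    refine key (switchUnary_runs (by decide) (n := 1) rfl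
      (by rw [hc, Gate.encode, List.append_assoc]) ((popLoop_exit (o := some b) (by simp)
        (push_runs _ _ _) rfl).congr
        ?_ le_rfl)) ?_
    · funext r
      cases r <;> simp [Gate.shift, Gate.encode]
    · simp [Gate.encode, length_encodeUnary]
  | not j =>
    refine key (switchUnary_runs (by decide) (n := 2) rfl
      (by rw [hc, Gate.encode, List.append_assoc]) ((reference_runs (j := j) (l := l) (p := p)
        (by simp [ht]) (by simp [hp]) (by simp)).congr ?_ le_rfl)) ?_
    · funext r
      cases r <;> simp [Gate.shift, Gate.encode]
    · simp [Gate.encode, length_encodeUnary]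
      omega
  | and j k =>
    refine key (switchUnary_runs (by decide) (n := 3) rfl
      (by rw [hc, Gate.encode, List.append_assoc]) ((two (j := j) (k := k)
        (by simp [ht]) (by simp [hp]) (by simp)).congr ?_ le_rfl)) ?_
    · funext r
      cases r <;> simp [Gate.shift, Gate.encode]
    · simp [Gate.encode, length_encodeUnary]
      omega
  | or j k =>
    refine key (switchUnary_runs (by decide) (n := 4) rfl
      (by rw [hc, Gate.encode, List.append_assoc]) ((two (j := j) (k := k)
        (by simp [ht]) (by simp [hp]) (by simp)).congr ?_ le_rfl)) ?_
    · funext r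
      cases r <;> simp [Gate.shift, Gate.encode]
    · simp [Gate.encode, length_encodeUnary]
      omega

theorem readGates_runs {a p m n : ℕ} {f : Fin m → Fin n} (hf : ∀ i, (f i : ℕ) = a + i)
    {gs : List (Gate m)} {s : Reg → Str} (ht : s tmp = []) (ha : s inputs = List.replicate a true)
    (hp : s last = List.replicate p true) (hc : s circ = gs.flatMap Gate.encode) :
    (whileNonempty circ readGate : Prog M Reg).Runs s
      (update (update (update s circ [])
        acc (((gs.map (Gate.shift f (p + 1))).flatMap Gate.encode).reverse ++ s acc))
        count (List.replicate gs.length true ++ s count))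
      (2 * (gs.flatMap Gate.encode).length + gs.length * (5 * a + 10 * p + 22) + 2) := by
  induction gs generalizing s with
  | nil =>
    refine (whileNonempty_nil hc).congr ?_ (by simp)
    funext r
    cases r <;> simp [hc]
  | cons g gs ih =>
    have hne : s circ ≠ [] := by
      have := g.length_encode_pos
      rw [hc, List.flatMap_cons]
      intro h
      rw [(List.append_eq_nil_iff.1 h).1] at this
      simp at this
    refine (whileNonempty_cons hne (readGate_runs (l := gs.flatMap Gate.encode) hf ht ha hp
      (by rw [hc, List.flatMap_cons]))
      (ih (by simp [ht]) (by simp [ha]) (by simp [hp]) (by simp))).congr ?_ ?_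
    · funext r
      cases r <;> simp [replicate_append_cons, List.replicate_succ]
    · simp only [List.flatMap_cons, List.length_append, List.length_cons, Nat.succ_mul]
      omega

/-- The registers while the instance `c` is stored in reversed codes. -/
def regs (inp key grp rest tmp : Str) (c : CircuitInstance) : Reg → Str
  | .inp => inp
  | .key => key
  | .grp => grp
  | .rest => rest
  | .tmp => tmp
  | .inputs => List.replicate c.strings.length true
  | .last => List.replicate (c.circuit.size - 1) true
  | .acc => c.circuit.encode.reverse
  | .strs => (encodeSeq c.strings).reverse
  | _ => []

/-- Read a string from `inp`. Write it to `grp` or to `rest`, depending on whether its parameter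
value is the one in `key`. -/
noncomputable def selectString : Prog M Reg :=
  (readStr inp word code ⨟ call .param word key' ⨟ compareKeys) ⨟
  popLoop flag (fun _ => false) fun o => o.elim (move code tmp ⨟ move tmp grp) fun _ =>
    clear flag ⨟ move code tmp ⨟ move tmp rest

/-- Parameter values are compared through their binary codes. The two moves through `tmp` cancel
each other's reversal, so `grp` and `rest` collect reversed codes of sequences, ready for `call` and
`move`. -/
theorem selectString_runs {κ : Str → ℕ} {w l k g r : Str} {c : CircuitInstance} {L B : ℕ} {n : ℕ}
    (hM : Answers (M .param) w (Computability.encodeNat (κ w)) B)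
    (hw : w.length ≤ L) (hk : (Computability.encodeNat n).length ≤ B)
    (hB : (Computability.encodeNat (κ w)).length ≤ B)
    (hn : k = (Computability.encodeNat n).reverse) :
    (selectString : Prog M Reg).Runs (regs (encodeStr w ++ l) k g r [] c)
      (if κ w = n then regs l k ((encodeStr w).reverse ++ g) r [] c
        else regs l k g ((encodeStr w).reverse ++ r) [] c) (20 * (L + B + 2)) := by
  subst hn
  have hinj : (Computability.encodeNat n).reverse = (Computability.encodeNat (κ w)).reverse ↔
      κ w = n := by
    rw [List.reverse_inj]
    constructor
    · intro h
      rw [← Computability.decode_encodeNat n, h, Computability.decode_encodeNat]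
    · rintro rfl; rfl
  set k := (Computability.encodeNat n).reverse with hkdef
  set k' := (Computability.encodeNat (κ w)).reverse with hkdef'
  have lk : k.length ≤ B := by simpa [k] using hk
  have lk' : k'.length ≤ B := by simpa [k'] using hB
  have h1 : (readStr inp word code ⨟ call .param word key' ⨟ compareKeys : Prog M Reg).Runs
      (regs (encodeStr w ++ l) k g r [] c)
      (update (update (regs l k g r [] c) code (encodeStr w).reverse) flag
        (List.replicate (mismatches k k' + (k'.drop k.length).length) true))
      (6 * L + 10 * B + 10) := by
    refine Prog.Runs.congr ((readStr_runs (l := l) (w := w) (by decide) (by decide) (by decide)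
      (by simp [regs])).seq
      ((call_runs .param word key' _ (w := Computability.encodeNat (κ w)) (t := B) ?_).seq
        (compareKeys_runs ?_))) ?_ ?_
    · simpa [regs] using hM
    · simp [regs]
    · funext r
      cases r <;> simp [regs, k']
    · simp [regs, hkdef'] at lk' lk ⊢
      omega
  have hd : (k'.drop k.length).length ≤ B := by rw [List.length_drop]; omega
  have hm := mismatches_le k k'
  have hsize : (encodeStr w).length = 2 * w.length + 1 := length_encodeStr w
  by_cases he : κ w = n
  · have h0 : mismatches k k' + (k'.drop k.length).length = 0 :=
      mismatches_add_eq_zero.2 (hinj.2 he)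
    rw [if_pos he]
    rw [h0] at h1
    rw [selectString]
    refine Prog.Runs.congr (h1.seq (popLoop_exit (o := none) (by simp)
      ((move_runs (by decide) _).seq (move_runs (by decide) _)) rfl)) ?_ ?_
    · funext r
      cases r <;> simp [regs]
    · simp [regs, hsize]
      omega
  · have h0 : mismatches k k' + (k'.drop k.length).length ≠ 0 := fun h =>
      he (hinj.1 (mismatches_add_eq_zero.1 h))
    obtain ⟨m, hm'⟩ := Nat.exists_eq_succ_of_ne_zero h0
    rw [if_neg he]
    have : m ≤ 2 * B := by omega
    rw [hm'] at h1
    rw [selectString]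
    refine Prog.Runs.congr (h1.seq (popLoop_exit (o := some true) (by simp [List.replicate_succ])
      ((clear_runs _ _).seq ((move_runs (by decide) _).seq (move_runs (by decide) _)))
      rfl)) ?_ ?_
    · funext r
      cases r <;> simp [regs]
    · simp [regs, hsize]
      omega

theorem selectStrings_runs {κ : Str → ℕ} {xs : List Str} {k g r : Str} {c : CircuitInstance}
    {L B n : ℕ}
    (hM : ∀ w ∈ xs, Answers (M .param) w (Computability.encodeNat (κ w)) B ∧ w.length ≤ L ∧
      (Computability.encodeNat (κ w)).length ≤ B)
    (hk : (Computability.encodeNat n).length ≤ B) (hn : k = (Computability.encodeNat n).reverse) :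
    (whileNonempty inp selectString : Prog M Reg).Runs (regs (encodeSeq xs) k g r [] c)
      (regs [] k ((encodeSeq (xs.filter fun w => decide (κ w = n))).reverse ++ g)
        ((encodeSeq (xs.filter fun w => !decide (κ w = n))).reverse ++ r) [] c)
      (xs.length * (20 * (L + B + 2) + 2) + 2) := by
  induction xs generalizing g r with
  | nil => exact (whileNonempty_nil rfl).congr (by simp [encodeSeq]) (by simp)
  | cons w xs ih =>
    obtain ⟨h1, h2, h3⟩ := hM w (by simp)
    have hs := selectString_runs (l := encodeSeq xs) (g := g) (r := r) (c := c) h1 h2 hk h3 hn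
    have hne : regs (encodeSeq (w :: xs)) k g r [] c inp ≠ [] := by
      cases w <;> simp [regs, encodeSeq_cons, encodeStr]
    by_cases hw : κ w = n
    · rw [if_pos hw] at hs
      refine (whileNonempty_cons hne hs (ih fun w hw => hM w (by simp [hw]))).congr ?_ ?_
      · simp [hw, encodeSeq_cons]
      · rw [List.length_cons, Nat.succ_mul xs.length]
        omega
    · rw [if_neg hw] at hs
      refine (whileNonempty_cons hne hs (ih fun w hw => hM w (by simp [hw]))).congr ?_ ?_
      · simp [hw, encodeSeq_cons]
      · rw [List.length_cons, Nat.succ_mul xs.length]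
        omega

/-- Read strings from `ker`, write their codes to `strs`, and count the strings in `inputs`. -/
def readStrings : Prog M Reg :=
  whileNonempty ker (readStr ker word strs ⨟ clear word ⨟ push inputs true)

theorem readStrings_runs {xs : List Str} {s : Reg → Str} (hw : s word = [])
    (h : s ker = encodeSeq xs) :
    (readStrings : Prog M Reg).Runs s
      (update (update (update s ker []) strs ((encodeSeq xs).reverse ++ s strs))
        inputs (List.replicate xs.length true ++ s inputs)) (7 * (encodeSeq xs).length + 2) := by
  induction xs generalizing s with
  | nil =>
    refine (whileNonempty_nil h).congr ?_ (by simp)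
    funext r
    cases r <;> simp [encodeSeq, h]
  | cons x xs ih =>
    refine Prog.Runs.congr (whileNonempty_cons ?_ ((readStr_runs (w := x) (l := encodeSeq xs)
      (by decide) (by decide) (by decide) h).seq ((clear_runs _ _).seq (push_runs _ _ _)))
      (ih (by simp) (by simp))) ?_ ?_
    · rw [h]
      cases x <;> simp [encodeSeq_cons, encodeStr]
    · funext r
      cases r <;> simp [encodeSeq_cons, hw, replicate_append_cons, List.replicate_succ]
    · simp [encodeSeq_cons, length_encodeStr, hw]
      omega

/-- Combine the stored instance with the instance whose reversed code is in `tmp`. -/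
def mergeInstance (o : Bool) : Prog M Reg :=
  (move tmp ker ⨟ readStr ker tmp code ⨟ clear code ⨟ move tmp circ) ⨟
  whileNonempty circ readGate ⨟
  (pushStr acc (encodeUnary (if o then 3 else 4)) ⨟ copy last acc tmp ⨟ push acc false ⨟
    copy last acc tmp ⨟ copy count acc tmp ⨟ push acc false ⨟ move count last ⨟
    push last true) ⨟
  readStrings

/-- The gates of `d` are appended with shifted references, then the junction gate, and finally the
strings of `d`. The product in the time bound arises because each gate may require copying unary
offsets of length up to `U`. -/
theorem mergeInstance_runs {o : Bool} {l : Str} {c d : CircuitInstance} {Z U : ℕ}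
    (hd : d.encode.length ≤ Z) (hc : c.strings.length ≤ U) (hc' : c.circuit.size ≤ U) :
    (mergeInstance o : Prog M Reg).Runs (regs l [] [] [] d.encode.reverse c)
      (regs l [] [] [] [] (.merge o c d)) ((Z + 1) * (15 * U + 60)) := by
  have hcpos : 0 < c.circuit.size := List.length_pos_of_ne_nil c.circuit.gates_ne_nil
  have hdpos : 0 < d.circuit.size := List.length_pos_of_ne_nil d.circuit.gates_ne_nil
  obtain ⟨p, hp⟩ : ∃ p, c.circuit.size = p + 1 := ⟨c.circuit.size - 1, by omega⟩
  have hdl : d.encode.length = (2 * d.circuit.encode.length + 1) +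
      (encodeSeq d.strings).length := by
    rw [CircuitInstance.encode, encodeSeq_cons, List.length_append, length_encodeStr]
  have hsize := d.circuit.size_le_length_encode
  have h1 : (move tmp ker ⨟ readStr ker tmp code ⨟ clear code ⨟ move tmp circ : Prog M Reg).Runs
      (regs l [] [] [] d.encode.reverse c)
      (update (update (regs l [] [] [] [] c) ker (encodeSeq d.strings)) circ d.circuit.encode)
      (11 * Z + 10) := by
    refine Prog.Runs.congr ((move_runs (by decide) _).seq ((readStr_runs (w := d.circuit.encode)
      (l := encodeSeq d.strings) (by decide) (by decide) (by decide) ?_).seq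
      ((clear_runs _ _).seq (move_runs (by decide) _)))) ?_ ?_
    · simp [regs, CircuitInstance.encode, encodeSeq_cons]
    · funext r
      cases r <;> simp [regs]
    · simp [regs, length_encodeStr]
      omega
  set gs : List (Gate (c.strings ++ d.strings).length) := d.circuit.gates.map (Gate.shift (fun i =>
    (⟨c.strings.length + i, by simp⟩ : Fin (c.strings ++ d.strings).length)) (p + 1)) with hgs
  have h2 := readGates_runs (M := M) (a := c.strings.length) (p := p) (gs := d.circuit.gates)
    (f := fun i => (⟨c.strings.length + i, by simp⟩ : Fin (c.strings ++ d.strings).length))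
    (s := update (update (regs l [] [] [] [] c) ker (encodeSeq d.strings)) circ d.circuit.encode)
    (fun i => rfl) (by simp [regs]) (by simp [regs]) (by simp [regs, hp])
    (by simp [Circuit.encode])
  rw [← hgs] at h2
  set s2 := update (update (update (update (update (regs l [] [] [] [] c) ker
    (encodeSeq d.strings)) circ d.circuit.encode) circ []) acc
    ((gs.flatMap Gate.encode).reverse ++ update (update (regs l [] [] [] [] c) ker
    (encodeSeq d.strings)) circ d.circuit.encode acc)) count (List.replicate d.circuit.gates.length
      true ++ update (update (regs l [] [] [] [] c) ker
    (encodeSeq d.strings)) circ d.circuit.encode count) with hs2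
  -- The circuit is complete at this point, but `inputs` and `strs` still describe `c` alone: the
  -- strings of `d` are read last because the shift of input gates uses the old count.
  have h3 : (pushStr acc (encodeUnary (if o then 3 else 4)) ⨟ copy last acc tmp ⨟ push acc false ⨟
      copy last acc tmp ⨟ copy count acc tmp ⨟ push acc false ⨟ move count last ⨟
      push last true : Prog M Reg).Runs s2 (update (regs l [] [] [] [] (.merge o c d)) ker
        (encodeSeq d.strings) |> (update · inputs (List.replicate c.strings.length true)) |>
        (update · strs (encodeSeq c.strings).reverse)) (10 * U + 7 * Z + 30) := by
    have henc := CircuitInstance.encode_circuit_merge o c d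
    have hun : ∀ n, encodeUnary n = List.replicate n true ++ [false] := fun n =>
      encodeUnary_add n 0
    -- The second reference of the junction is the number of new gates plus `p`, hence is written by
    -- copying `last` and `count` in a row.
    have hjunc : (Gate.junction (n := 0) o p (d.circuit.size + p)).encode =
        encodeUnary (if o then 3 else 4) ++ (List.replicate p true ++
          (false :: (List.replicate d.circuit.gates.length true ++
            (List.replicate p true ++ [false])))) := by
      have : List.replicate d.circuit.gates.length true ++ (List.replicate p true ++ [false]) =
          encodeUnary (d.circuit.size + p) := by
        rw [hun, List.replicate_add, List.append_assoc, Circuit.size]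
      rw [this]
      cases o <;> simp [Gate.junction, Gate.encode, hun p]
    rw [hp, ← hgs, Nat.add_sub_cancel,
      show p + 1 + d.circuit.size - 1 = d.circuit.size + p by omega, hjunc] at henc
    refine Prog.Runs.congr ((pushStr_runs _ _ _).seq ((copy_runs (by decide) (by decide)
      (by decide) ?_).seq ((push_runs _ _ _).seq ((copy_runs (by decide) (by decide)
      (by decide) ?_).seq ((copy_runs (by decide) (by decide)
      (by decide) ?_).seq ((push_runs _ _ _).seq ((move_runs (by decide) _).seq
      (push_runs _ _ _)))))))) ?_ ?_
    · simp [hs2, regs]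
    · simp [hs2, regs]
    · simp [hs2, regs]
    · funext r
      cases r
      case acc =>
        simp [hs2, regs, henc, hp]
        rw [Nat.add_comm p, List.replicate_add, List.append_assoc]
      -- The merged circuit has `p + 1` old gates, the gates of `d` and the junction, so its output
      -- position is the count of new gates plus `p` plus `1`.
      case last =>
        simp [hs2, regs, hp, CircuitInstance.size_merge]
        rw [← List.replicate_succ, Circuit.size]
        congr 1
        omega
      all_goals simp [hs2, regs]
    · have : (encodeUnary (if o then 3 else 4)).length ≤ 5 := by cases o <;> simp [encodeUnary]
      have hg : d.circuit.gates.length = d.circuit.size := rfl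
      simp [hs2, regs, hp, hg]
      omega
  refine Prog.Runs.congr (h1.seq (h2.seq (h3.seq
    (readStrings_runs (xs := d.strings) ?_ ?_)))) ?_ ?_
  · simp [regs]
  · simp
  · funext r
    cases r
    case strs => simp [regs, CircuitInstance.merge, encodeSeq_append]
    case inputs =>
      simp [regs, CircuitInstance.merge, Nat.add_comm c.strings.length]
    all_goals simp [regs]
  · have hg : d.circuit.gates.length * (5 * c.strings.length + 10 * p + 22) ≤
        Z * (15 * U + 22) := by
      have : d.circuit.gates.length = d.circuit.size := rfl
      gcongr ?_ * ?_ <;> omega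
    have hg' : (d.circuit.gates.flatMap Gate.encode).length = d.circuit.encode.length := rfl
    have hZ : (Z + 1) * (15 * U + 60) = Z * (15 * U + 22) + 38 * Z + 15 * U + 60 := by ring
    rw [hZ, hg']
    omega

/-- Compose the strings in `inp` that have the same parameter value as the first one, kernelize the
result, and combine the stored instance with the instance obtained. Leave the other strings in
`inp`. -/
noncomputable def processGroup (o : Bool) : Prog M Reg :=
  (readStr inp word code ⨟ call .param word key ⨟ move code tmp ⨟ move tmp grp) ⨟
  whileNonempty inp selectString ⨟
  (clear key ⨟ move rest inp ⨟ call .comp grp ans ⨟ call .kern ans tmp) ⨟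
  mergeInstance o

/-- A single bound `N` covers all lengths and oracle times. The square comes from up to `N`
selections of cost linear in `N`, and from the merge. -/
theorem processGroup_runs {o : Bool} {κ : Str → ℕ} {x y : Str} {xs : List Str}
    {c d : CircuitInstance} {N : ℕ} (hN : (encodeSeq (x :: xs)).length ≤ N)
    (hκ : ∀ w ∈ x :: xs, Answers (M .param) w (Computability.encodeNat (κ w)) N ∧
      (Computability.encodeNat (κ w)).length ≤ N)
    (hy : Answers (M .comp) (encodeSeq (x :: xs.filter fun w => decide (κ w = κ x))) y N)
    (hyN : y.length ≤ N) (hd : Answers (M .kern) y d.encode N) (hdN : d.encode.length ≤ N)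
    (hc : c.strings.length ≤ N) (hc' : c.circuit.size ≤ N) :
    (processGroup o : Prog M Reg).Runs (regs (encodeSeq (x :: xs)) [] [] [] [] c)
      (regs (encodeSeq (xs.filter fun w => !decide (κ w = κ x))) [] [] [] [] (.merge o c d))
      (100 * (N + 1) ^ 2) := by
  have hx := hκ x (by simp)
  have hN' := hN
  rw [encodeSeq_cons, List.length_append, length_encodeStr] at hN'
  have hlen := length_le_length_encodeSeq xs
  have hf := length_encodeSeq_filter_le (fun w => decide (κ w = κ x)) xs
  have hf' := length_encodeSeq_filter_le (fun w => !decide (κ w = κ x)) xs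
  set k := (Computability.encodeNat (κ x)).reverse with hk
  have lk : k.length ≤ N := by simpa [k] using hx.2
  have h1 : (readStr inp word code ⨟ call .param word key ⨟ move code tmp ⨟ move tmp grp :
      Prog M Reg).Runs (regs (encodeSeq (x :: xs)) [] [] [] [] c)
      (regs (encodeSeq xs) k (encodeStr x).reverse [] [] c) (14 * N + 20) := by
    refine Prog.Runs.congr ((readStr_runs (w := x) (l := encodeSeq xs) (by decide) (by decide)
      (by decide) (by simp [regs, encodeSeq_cons])).seq ((call_runs Oracle.param word key _
      (w := Computability.encodeNat (κ x)) (t := N) ?_).seq ((move_runs (a := code) (b := tmp)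
      (by decide) _).seq (move_runs (a := tmp) (b := grp) (by decide) _)))) ?_ ?_
    · simpa [regs] using hx.1
    · funext r
      cases r <;> simp [regs, k]
    · simp [regs, length_encodeStr, hk] at lk ⊢
      omega
  have h2 := selectStrings_runs (M := M) (xs := xs) (g := (encodeStr x).reverse) (r := [])
    (c := c) (L := N) (B := N) (n := κ x) (k := k) (fun w hw => ⟨(hκ w (by simp [hw])).1,
      (length_le_length_encodeSeq_of_mem (List.mem_cons_of_mem _ hw)).trans hN,
      (hκ w (by simp [hw])).2⟩) hx.2 rfl
  have h3 : (clear key ⨟ move rest inp ⨟ call .comp grp ans ⨟ call .kern ans tmp :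
      Prog M Reg).Runs (regs [] k ((encodeSeq (xs.filter fun w => decide (κ w = κ x))).reverse ++
        (encodeStr x).reverse) ((encodeSeq (xs.filter fun w => !decide (κ w = κ x))).reverse ++ [])
        [] c)
      (regs (encodeSeq (xs.filter fun w => !decide (κ w = κ x))) [] [] [] d.encode.reverse c)
      (10 * N + 10) := by
    refine Prog.Runs.congr ((clear_runs _ _).seq ((move_runs (by decide) _).seq
      ((call_runs Oracle.comp grp ans _ (w := y) (t := N) ?_).seq
      (call_runs Oracle.kern ans tmp _ (w := d.encode) (t := N) ?_)))) ?_ ?_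
    · simpa [regs, encodeSeq_cons] using hy
    · simpa [regs] using hd
    · funext r
      cases r <;> simp [regs]
    · simp [regs, length_encodeStr] at lk ⊢
      omega
  refine Prog.Runs.congr (h1.seq (h2.seq (h3.seq (mergeInstance_runs hdN hc hc')))) rfl ?_
  have : xs.length * (20 * (N + N + 2) + 2) ≤ N * (20 * (N + N + 2) + 2) := by
    gcongr
    omega
  nlinarith

/-- Induction on a bound `n` for the number of remaining parameter values. `H` packages composing
and kernelizing a group. Kernels are bounded twice: by `Z`, which controls the time, and by `Q`,
which controls the output. The last two hypotheses keep the growing instance below `N` throughout;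
each merge adds at most `Z` strings and `Z + 1` gates, one of them the junction. -/
theorem processGroups_run {o : Bool} {κ : Str → ℕ} {X : Set Str} {N Z Q n L : ℕ} (hL : L ≤ N)
    {xs : List Str} {c : CircuitInstance} (hn : (xs.map κ).toFinset.card ≤ n)
    (hxs : (encodeSeq xs).length ≤ L)
    (hκ : ∀ w ∈ xs, Answers (M .param) w (Computability.encodeNat (κ w)) N ∧
      (Computability.encodeNat (κ w)).length ≤ N)
    (hZ : Z ≤ N)
    (H : ∀ g ⊆ xs, g ≠ [] → (∀ x ∈ g, ∀ y ∈ g, κ x = κ y) → (encodeSeq g).length ≤ L →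
      ∃ (y : Str) (d : CircuitInstance), Answers (M .comp) (encodeSeq g) y N ∧ y.length ≤ N ∧
        Answers (M .kern) y d.encode N ∧ d.encode.length ≤ Z ∧ (d.Accepts X ↔ Holds o X g) ∧
        d.strings.length ≤ Q ∧ (∀ q ∈ d.strings, q.length ≤ Q) ∧ d.circuit.size ≤ Q)
    (hc : c.strings.length + n * Z ≤ N) (hc' : c.circuit.size + n * (Z + 1) ≤ N) :
    ∃ c' : CircuitInstance,
      (whileNonempty inp (processGroup o) : Prog M Reg).Runs
        (regs (encodeSeq xs) [] [] [] [] c) (regs [] [] [] [] [] c')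
        (n * (100 * (N + 1) ^ 2 + 2) + 2) ∧
      (c'.Accepts X ↔ if o then c.Accepts X ∧ Holds o X xs else c.Accepts X ∨ Holds o X xs) ∧
      c'.strings.length ≤ c.strings.length + n * Q ∧
      (∀ q ∈ c'.strings, q ∈ c.strings ∨ q.length ≤ Q) ∧
      c'.circuit.size ≤ c.circuit.size + n * (Q + 1) := by
  induction n generalizing xs c with
  | zero =>
    have : xs = [] := by simpa using hn
    subst this
    refine ⟨c, (whileNonempty_nil rfl).congr rfl (by simp), ?_, by simp, fun q => .inl, by simp⟩
    cases o <;> simp [Holds]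
  | succ n ih =>
    cases xs with
    | nil =>
      refine ⟨c, (whileNonempty_nil rfl).congr rfl (by simp), ?_, by simp, fun q => .inl, by simp⟩
      cases o <;> simp [Holds]
    | cons x xs =>
      rw [Nat.succ_mul n] at hc hc'
      have hsub : (xs.filter fun w => decide (κ w = κ x)) ⊆ xs := List.filter_subset_self _
      have hsub' : (xs.filter fun w => !decide (κ w = κ x)) ⊆ xs := List.filter_subset_self _
      have hxs' := hxs
      rw [encodeSeq_cons, List.length_append] at hxs'
      have hkey : ∀ w ∈ x :: xs.filter (fun w => decide (κ w = κ x)), κ w = κ x := by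
        intro w hw
        rcases List.mem_cons.1 hw with rfl | hw
        · rfl
        · simpa using (List.mem_filter.1 hw).2
      obtain ⟨y, d, hy, hyN, hd, hdZ, hX, hQ, hQ', hQs⟩ :=
        H (x :: xs.filter fun w => decide (κ w = κ x)) (List.cons_subset_cons _ hsub) (by simp)
          (fun v hv w hw => (hkey v hv).trans (hkey w hw).symm) (by
            have := length_encodeSeq_filter_le (fun w => decide (κ w = κ x)) xs
            rw [encodeSeq_cons, List.length_append]
            omega)
      have h1 := processGroup_runs (o := o) (c := c) (hxs.trans hL) hκ hy hyN hd (hdZ.trans hZ)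
        (by omega) (by omega)
      have hdl : d.encode.length = (2 * d.circuit.encode.length + 1) +
          (encodeSeq d.strings).length := by
        rw [CircuitInstance.encode, encodeSeq_cons, List.length_append, length_encodeStr]
      have hds := d.circuit.size_le_length_encode
      have hdn := length_le_length_encodeSeq d.strings
      have hsz := CircuitInstance.size_merge o c d
      have hst : (CircuitInstance.merge o c d).strings = c.strings ++ d.strings := rfl
      obtain ⟨c', hrun, hacc, hl, hq, hs⟩ := ih
        (xs := xs.filter fun w => !decide (κ w = κ x)) (c := .merge o c d)
        (by have := card_image_filter_lt (κ := κ) x xs; omega)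
        (by have := length_encodeSeq_filter_le (fun w => !decide (κ w = κ x)) xs; omega)
        (fun w hw => hκ w (List.mem_cons_of_mem _ (hsub' hw)))
        (fun g hg => H g fun w hw => List.mem_cons_of_mem _ (hsub' (hg hw)))
        (by rw [hst, List.length_append]; omega) (by rw [hsz]; omega)
      refine ⟨c', ?_, ?_, ?_, ?_, ?_⟩
      · refine (whileNonempty_cons ?_ h1 hrun).congr rfl ?_
        · cases x <;> simp [regs, encodeSeq_cons, encodeStr]
        · rw [Nat.succ_mul n]
          omega
      · rw [hacc, CircuitInstance.accepts_merge,
          holds_cons_filter (xs := xs) (p := fun w => decide (κ w = κ x)), hX]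
        cases o <;> simp [and_assoc, or_assoc]
      · rw [hst, List.length_append] at hl
        rw [Nat.succ_mul n]
        omega
      · intro q h
        rcases hq q h with h | h
        · rcases List.mem_append.1 h with h | h
          · exact .inl h
          · exact .inr (hQ' q h)
        · exact .inr h
      · rw [hsz] at hs
        rw [Nat.succ_mul n]
        omega

/-- Write the code of the stored instance to `out`. -/
def writeInstance : Prog M Reg :=
  clear inputs ⨟ clear last ⨟ move strs out ⨟ push out false ⨟
  popLoop acc Option.isSome fun o => o.elim skip fun b => push out b ⨟ push out true

/-- The output is built from its end: first the strings, then the end mark of the circuit code, then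
the bits of that code from last to first, each preceded by its mark. -/
theorem writeInstance_runs (c : CircuitInstance) :
    (writeInstance : Prog M Reg).Runs (regs [] [] [] [] [] c) (update (fun _ => []) out c.encode)
      (10 * c.encode.length + 10) := by
  have key : ∀ (u v l : Str) (s : Reg → Str), s acc = u → s out = encodeStr v ++ l →
      (popLoop acc Option.isSome fun o => o.elim skip fun b => push out b ⨟ push out true :
        Prog M Reg).Runs s (update (update s acc []) out (encodeStr (u.reverse ++ v) ++ l))
        (3 * u.length + 2) := by
    intro u
    induction u with
    | nil =>
      intro v l s hu hv
      refine popLoop_exit (o := none) (by simp [hu]) ((skip_runs _).congr ?_ le_rfl) rfl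
      funext r
      cases r <;> simp [hu, hv]
    | cons b u ih =>
      intro v l s hu hv
      refine (popLoop_again (o := some b) (by simp [hu]) ((push_runs _ _ _).seq (push_runs _ _ _))
        rfl (ih (b :: v) l _ (by simp [hu]) (by simp [hv, encodeStr]))).congr ?_ ?_
      · funext r
        cases r <;> simp
      · simp only [List.length_cons]
        omega
  have hl : c.encode.length = (2 * c.circuit.encode.length + 1) +
      (encodeSeq c.strings).length := by
    rw [CircuitInstance.encode, encodeSeq_cons, List.length_append, length_encodeStr]
  have hs := c.circuit.size_le_length_encode
  have hn := length_le_length_encodeSeq c.strings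
  refine Prog.Runs.congr ((clear_runs _ _).seq ((clear_runs _ _).seq
    ((move_runs (by decide) _).seq ((push_runs _ _ _).seq
    (key c.circuit.encode.reverse [] (encodeSeq c.strings) _ ?_ ?_))))) ?_ ?_
  · simp [regs]
  · simp [regs, encodeStr]
  · funext r
    cases r <;> simp [regs, CircuitInstance.encode, encodeSeq_cons]
  · simp [regs]
    omega

/-- The distillation: group the strings by their parameter values, compose and kernelize each group,
and combine the resulting instances. -/
noncomputable def distill (o : Bool) : Prog M Reg :=
  pushStr acc [true, false, o] ⨟ whileNonempty inp (processGroup o) ⨟ writeInstance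

/-- The three bits are the code of a constant gate of value `o`, the neutral element of the chosen
connective. The register `last` is rightly empty, the output gate being at position `0`. -/
theorem distill_start (o : Bool) (w : Str) :
    (pushStr acc [true, false, o] : Prog M Reg).Runs (update (fun _ => []) inp w)
      (regs w [] [] [] [] (.const o)) 4 := by
  refine (pushStr_runs _ _ _).congr ?_ le_rfl
  funext r
  cases r <;> simp [regs, CircuitInstance.const, Circuit.size, Circuit.encode, encodeSeq,
    Gate.encode, encodeUnary]

end Distillation

/-- Fixes the polynomials and feeds them to the loop invariant. The key point is that the number of
groups is at most `pb.eval m + 1`. -/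
theorem exists_distillation {o : Bool} {X : Set Str} {κ : Str → ℕ} (hκ : IsParameterization κ)
    (hκb : ∃ p : Polynomial ℕ, ∀ x, κ x ≤ p.eval x.length) (hK : HasPsizeKernelization X κ)
    {f : SameParameter κ → Str} (hf : PolyTime (fun xs : SameParameter κ => encodeSeq xs.1) id f)
    (hX : ∀ xs, f xs ∈ X ↔ Holds o X xs.1)
    (hp : ∃ p : Polynomial ℕ, ∀ xs, ∀ x ∈ xs.1, κ (f xs) ≤ p.eval (κ x)) :
    ∃ F : List Str → Str, PolyTime encodeSeq id F ∧
      (∀ xs, F xs ∈ circuitSet X ↔ Holds o X xs) ∧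
      ∃ p : Polynomial ℕ, ∀ xs, (F xs).length ≤ p.eval (maxLength xs) := by
  obtain ⟨pb, hpb⟩ := hκb
  obtain ⟨K, hKt, hKX, pk, hpk⟩ := hK
  obtain ⟨pc, hpc⟩ := hp
  obtain ⟨Mκ, tκ, hMκ⟩ := hκ.exists_oracle
  obtain ⟨Mf, tf, hMf⟩ := hf.exists_oracle
  obtain ⟨MK, tK, hMK⟩ := hKt.exists_oracle
  let M : Oracle → Turing.TM2ComputableAux Bool Bool
    | .param => Mκ
    | .comp => Mf
    | .kern => MK
  -- Kernel size in terms of `m`: bound the parameter by `pb`, pass to the composed string by `pc`,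
  -- then kernelize by `pk`.
  let PQ : Polynomial ℕ := pk.comp (pc.comp pb)
  -- The bound of `CircuitInstance.length_encode_le` for `pb + 1` kernels of size `PQ`, with one
  -- junction per kernel and the initial constant gate.
  let PE : Polynomial ℕ :=
    2 * ((1 + (pb + 1) * (PQ + 1)) * (7 + (pb + 1) * PQ + 2 * (1 + (pb + 1) * (PQ + 1)))) + 1 +
      (pb + 1) * PQ * (2 * PQ + 1)
  -- Covers the input, the three oracles, and the growth of the stored instance over at most `L`
  -- rounds.
  let PN : Polynomial ℕ := .X + tκ + tf + tK.comp tf + .X * (tK.comp tf + 1) + 1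
  have main : ∀ xs : List Str, ∃ c : CircuitInstance,
      (distill o : Prog M Reg).Runs (Function.update (fun _ => []) .inp (encodeSeq xs))
        (Function.update (fun _ => []) .out c.encode)
        ((4 + (.X * (100 * (PN + 1) ^ 2 + 2) + 2) + (10 * PE + 10) : Polynomial ℕ).eval
          (encodeSeq xs).length) ∧
      (c.Accepts X ↔ Holds o X xs) ∧ c.encode.length ≤ PE.eval (maxLength xs) := by
    intro xs
    set L := (encodeSeq xs).length with hL
    set m := maxLength xs with hm
    have hN : PN.eval L = L + tκ.eval L + tf.eval L + tK.eval (tf.eval L) +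
        L * (tK.eval (tf.eval L) + 1) + 1 := by
      simp [PN, Polynomial.eval_comp]
    have hκm : ∀ x ∈ xs, κ x ≤ pb.eval m := fun x hx =>
      (hpb x).trans (eval_mono pb (length_le_maxLength hx))
    have hxL : ∀ x ∈ xs, x.length ≤ L := fun x hx => length_le_length_encodeSeq_of_mem hx
    have hmL : m ≤ L := maxLength_le_length_encodeSeq xs
    have hcard : (xs.map κ).toFinset.card ≤ L :=
      (List.toFinset_card_le _).trans (by
        rw [List.length_map]
        exact length_le_length_encodeSeq xs)
    -- The bound `L` on the number of groups suffices for the time, but the output length needs this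
    -- one, which does not depend on the number of strings.
    have hcard' : (xs.map κ).toFinset.card ≤ pb.eval m + 1 := by
      have : (xs.map κ).toFinset ⊆ Finset.range (pb.eval m + 1) := by
        intro k hk
        obtain ⟨x, hx, rfl⟩ := List.mem_map.1 (List.mem_toFinset.1 hk)
        exact Finset.mem_range.2 (Nat.lt_succ_of_le (hκm x hx))
      simpa using Finset.card_le_card this
    have hans : ∀ {A : Turing.TM2ComputableAux Bool Bool} {u v : Str} {s t : ℕ},
        Answers A u v s → s ≤ t → Answers A u v t := by
      rintro A u v s t ⟨h⟩ hst
      exact ⟨⟨h.toEvalsTo, h.steps_le_m.trans hst⟩⟩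
    have hmulL : ∀ n ≤ L, ∀ Z, n * Z ≤ L * Z := fun n hn Z => Nat.mul_le_mul_right Z hn
    have hmul := hmulL _ hcard (tK.eval (tf.eval L))
    have hmul' := hmulL _ hcard (tK.eval (tf.eval L) + 1)
    have hmul'' : L * tK.eval (tf.eval L) ≤ L * (tK.eval (tf.eval L) + 1) :=
      Nat.mul_le_mul_left _ (Nat.le_succ _)
    obtain ⟨c, hrun, hacc, hl, hq, hs⟩ := processGroups_run (M := M) (o := o) (κ := κ) (X := X)
      (N := PN.eval L) (Z := tK.eval (tf.eval L)) (Q := PQ.eval m) (L := L) (xs := xs)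
      (c := .const o) (n := (xs.map κ).toFinset.card) (by omega) le_rfl le_rfl
      (fun w hw => by
        have h1 := hMκ w
        have h2 : tκ.eval w.length ≤ tκ.eval L := eval_mono tκ (hxL w hw)
        exact ⟨hans h1.1 (h2.trans (by omega)), (h1.2.trans h2).trans (by omega)⟩)
      (by omega)
      (fun g hg hne hsame hgL => by
        have h1 := hMf ⟨g, hne, hsame⟩
        have h2 : tf.eval (encodeSeq g).length ≤ tf.eval L := eval_mono tf hgL
        have h3 := hMK (f ⟨g, hne, hsame⟩)
        have h4 : tK.eval (f ⟨g, hne, hsame⟩).length ≤ tK.eval (tf.eval L) :=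
          eval_mono tK (h1.2.trans h2)
        obtain ⟨x, hx⟩ := List.exists_mem_of_ne_nil g hne
        have h5 : pk.eval (κ (f ⟨g, hne, hsame⟩)) ≤ PQ.eval m := by
          simp only [PQ, Polynomial.eval_comp]
          exact eval_mono pk ((hpc ⟨g, hne, hsame⟩ x hx).trans (eval_mono pc (hκm x (hg hx))))
        obtain ⟨h6, h7, h8⟩ := hpk (f ⟨g, hne, hsame⟩)
        exact ⟨f ⟨g, hne, hsame⟩, K (f ⟨g, hne, hsame⟩), hans h1.1 (h2.trans (by omega)),
          (h1.2.trans h2).trans (by omega), hans h3.1 (h4.trans (by omega)), h3.2.trans h4,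
          (hKX _).symm.trans (hX _), h6.trans h5, fun q hq => (h7 q hq).trans h5, h8.trans h5⟩)
      (by simp only [CircuitInstance.const, List.length_nil]; omega)
      (by simp only [CircuitInstance.const, Circuit.size, List.length_singleton]; omega)
    have hE : c.encode.length ≤ PE.eval m := by
      have h1 : (xs.map κ).toFinset.card * PQ.eval m ≤ (pb.eval m + 1) * PQ.eval m := by gcongr
      have h2 : (xs.map κ).toFinset.card * (PQ.eval m + 1) ≤
        (pb.eval m + 1) * (PQ.eval m + 1) := by gcongr
      have := CircuitInstance.length_encode_le (c := c) (l := (pb.eval m + 1) * PQ.eval m)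
        (m := PQ.eval m) (n := 1 + (pb.eval m + 1) * (PQ.eval m + 1))
        (hl.trans (by simp only [CircuitInstance.const, List.length_nil]; omega))
        (fun q h => by simpa [CircuitInstance.const] using hq q h)
        (hs.trans (by
          simp only [CircuitInstance.const, Circuit.size, List.length_singleton]; omega))
      simpa [PE] using this
    refine ⟨c, ?_, ?_, hE⟩
    · refine Prog.Runs.congr ((distill_start o _).seq (hrun.seq (writeInstance_runs c))) rfl ?_
      have h1 : (xs.map κ).toFinset.card * (100 * (PN.eval L + 1) ^ 2 + 2) ≤
        L * (100 * (PN.eval L + 1) ^ 2 + 2) := hmulL _ hcard _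
      have h2 : PE.eval m ≤ PE.eval L := eval_mono PE hmL
      simp only [Polynomial.eval_add, Polynomial.eval_mul, Polynomial.eval_X, Polynomial.eval_pow,
        Polynomial.eval_ofNat, Polynomial.eval_one]
      omega
    · rw [hacc, CircuitInstance.accepts_const]
      cases o <;> simp
  choose c hrun hacc hlen using main
  refine ⟨fun xs => (c xs).encode, polyTime_of_runs _ _ _ _ hrun, fun xs => ?_, PE, hlen⟩
  rw [encode_mem_circuitSet, hacc]

end Kernelization

theorem mainTheorem6 (X : Set Kernelization.Str) (κ : Kernelization.Str → ℕ)
    (hκ : Kernelization.IsParameterization κ)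
    (hκb : ∃ p : Polynomial ℕ, ∀ x, κ x ≤ p.eval x.length)
    (hK : Kernelization.HasPsizeKernelization X κ) :
    (Kernelization.IsAndCompositional X κ →
      Kernelization.HasWeakAndDistillation X (Kernelization.circuitSet X)) ∧
    (Kernelization.IsOrCompositional X κ →
      Kernelization.HasWeakOrDistillation X (Kernelization.circuitSet X)) := by
  constructor
  · rintro ⟨f, hf, hX, hp⟩
    obtain ⟨F, h1, h2, h3⟩ := Kernelization.exists_distillation (o := true) hκ hκb hK hf
      (by simpa [Kernelization.Holds] using hX) hp
    exact ⟨F, h1, by simpa [Kernelization.Holds] using h2, h3⟩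
  · rintro ⟨f, hf, hX, hp⟩
    obtain ⟨F, h1, h2, h3⟩ := Kernelization.exists_distillation (o := false) hκ hκb hK hf
      (by simpa [Kernelization.Holds] using hX) hp
    exact ⟨F, h1, by simpa [Kernelization.Holds] using h2, h3⟩
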